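/- Let $k$ be a perfect field. A linear category is a $k$-linear abelian category; linear functors are $k$-linear and right exact, and bilinear functors are linear (in particular right exact) in each variable. A linear category is finite if it has finite-dimensional spaces of morphisms, all its objects have finite length, it has enough projectives, and it has finitely many isomorphism classes of simple objects. A finite tensor category is a finite linear category with a monoidal structure whose tensor product is bilinear and in which every object has a left and a right dual. A left module category over a linear monoidal category $\mathcal C$ is a linear category $\mathcal M$ with a bilinear action $\otimes:\mathcal C\times\mathcal M\to\mathcal M$ and coherent associativity and unit isomorphisms; it is finite if the linear category $\mathcal M$ is finite. For $\mathcal C$ a finite tensor category, $\mathcal M$ is exact if $p\otimes m$ is projective for every projective $p\in\mathcal C$ and every $m\in\mathcal M$. The Deligne product $\mathcal A\boxtimes\mathcal B$ of two linear categories is a linear category with a bilinear functor $\boxtimes:\mathcal A\times\mathcal B\to\mathcal A\boxtimes\mathcal B$ such that, for every linear category $\mathcal L$, composition with $\boxtimes$ is an equivalence from the category of linear functors $\mathcal A\boxtimes\mathcal B\to\mathcal L$ to the category of bilinear functors $\mathcal A\times\mathcal B\to\mathcal L$. Let $\mathcal C$ and $\mathcal D$ be finite tensor categories over $k$, let $\mathcal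 M$ be an exact finite left $\mathcal C$-module category and let $\mathcal N$ be an exact finite left $\mathcal D$-module category. Let $\mathcal C\boxtimes\mathcal D$ carry its induced linear monoidal structure (that is, one with bilinear tensor product for which $\boxtimes:\mathcal C\times\mathcal D\to\mathcal C\boxtimes\mathcal D$ is a monoidal functor, where $\mathcal C\times\mathcal D$ has the componentwise monoidal structure), and let $\mathcal M\boxtimes\mathcal N$ carry its induced left $\mathcal C\boxtimes\mathcal D$-module structure (that is, one with bilinear action together with natural isomorphisms $(c\boxtimes d)\otimes(m\boxtimes n)\cong(c\otimes m)\boxtimes(d\otimes n)$ compatible with the associativity and unit isomorphisms). Then $\mathcal C\boxtimes\mathcal D$ is a finite tensor category and $\mathcal M\boxtimes\mathcal N$ is an exact finite left $\mathcal C\boxtimes\mathcal D$-module category. -/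

import Mathlib

open CategoryTheory CategoryTheory.Limits CategoryTheory.MonoidalCategory

universe w v u₁ u₂ u₃ u₄

/-!
# Finite tensor categories, module categories and the Deligne product

A *`k`-linear category* is a category `C` with `[Abelian C] [Linear k C]`.
-/

namespace FinTens

open scoped MonoidalLeftAction Prod

section Linear

variable (k : Type*) [Field k]

/-- A linear functor between linear categories: `k`-linear on morphisms and right exact. -/
structure IsLinearFunctor {A B : Type*} [Category* A] [Abelian A] [Linear k A]
    [Category* B] [Abelian B] [Linear k B] (F : A ⥤ B) : Prop where
  additive : F.Additive
  linear : F.Linear k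
  rightExact : PreservesFiniteColimits F

/-- A bilinear functor of two variables (in curried form): a linear, in particular right exact,
functor in each variable separately. -/
structure IsBilinearFunctor {A B L : Type*} [Category* A] [Abelian A] [Linear k A]
    [Category* B] [Abelian B] [Linear k B] [Category* L] [Abelian L] [Linear k L]
    (F : A ⥤ B ⥤ L) : Prop where
  /-- linearity of `F(a, -)` -/
  right (a : A) : IsLinearFunctor k (F.obj a)
  /-- linearity of `F(-, b)` -/
  left (b : B) : IsLinearFunctor k (F.flip.obj b)

/-- A finite linear category: finite-dimensional spaces of morphisms, all objects of finite length,
enough projectives, and finitely many isomorphism classes of simple objects. -/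
structure IsFiniteLinearCategory (C : Type*) [Category* C] [Abelian C] [Linear k C] : Prop where
  finiteDimensional_hom (X Y : C) : Module.Finite k (X ⟶ Y)
  artinian (X : C) : IsArtinianObject X
  noetherian (X : C) : IsNoetherianObject X
  enoughProjectives : EnoughProjectives C
  finitely_many_simples : ∃ (n : ℕ) (S : Fin n → C), ∀ X : C, Simple X → ∃ i, Nonempty (X ≅ S i)

end Linear

section Monoidal

variable (k : Type*) [Field k]

/-- A linear monoidal category: the tensor product is a bilinear functor. -/
def IsLinearMonoidal (C : Type*) [Category* C] [Abelian C] [Linear k C] [MonoidalCategory C] :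
    Prop :=
  IsBilinearFunctor k (curriedTensor C)

/-- A finite tensor category: a finite linear category with a linear monoidal structure which
is rigid, i.e. every object has a left dual and a right dual. -/
structure IsFiniteTensorCategory (C : Type*) [Category* C] [Abelian C] [Linear k C]
    [MonoidalCategory C] : Prop where
  finite : IsFiniteLinearCategory k C
  linearMonoidal : IsLinearMonoidal k C
  exists_leftDual (X : C) : Nonempty (HasLeftDual X)
  exists_rightDual (X : C) : Nonempty (HasRightDual X)

/-- A left module category over a linear monoidal category: a left action on a linear category
(with its associativity and unit isomorphisms) given by a bilinear functor. -/
def IsModuleCategory (C M : Type*) [Category* C] [Abelian C] [Linear k C] [MonoidalCategory C]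
    [Category* M] [Abelian M] [Linear k M] [MonoidalLeftAction C M] : Prop :=
  IsBilinearFunctor k (MonoidalLeftAction.curriedAction C M)

/-- A finite left module category: a left module category whose underlying linear category is
finite. -/
structure IsFiniteModuleCategory (C M : Type*) [Category* C] [Abelian C] [Linear k C]
    [MonoidalCategory C] [Category* M] [Abelian M] [Linear k M] [MonoidalLeftAction C M] :
    Prop where
  finite : IsFiniteLinearCategory k M
  moduleCategory : IsModuleCategory k C M

/-- Exactness of a module category: acting by a projective object gives projective objects. -/
def IsExactAction (C M : Type*) [Category* C] [MonoidalCategory C] [Category* M]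
    [MonoidalLeftAction C M] : Prop :=
  ∀ p : C, Projective p → ∀ m : M, Projective (p ⊙ₗ m)

end Monoidal

section Deligne

variable (k : Type*) [Field k]

/-- Linear functors between linear categories, as a property of functors. -/
def linearFunctors (A B : Type*) [Category* A] [Abelian A] [Linear k A]
    [Category* B] [Abelian B] [Linear k B] : ObjectProperty (A ⥤ B) :=
  fun F => IsLinearFunctor k F

/-- Bilinear functors between linear categories, as a property of functors. -/
def bilinearFunctors (A B L : Type*) [Category* A] [Abelian A] [Linear k A]
    [Category* B] [Abelian B] [Linear k B] [Category* L] [Abelian L] [Linear k L] :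
    ObjectProperty (A ⥤ B ⥤ L) :=
  fun F => IsBilinearFunctor k F

variable {A B P : Type*} [Category* A] [Abelian A] [Linear k A] [Category* B] [Abelian B]
  [Linear k B] [Category* P] [Abelian P] [Linear k P]

lemma IsLinearFunctor.comp {F : A ⥤ B} (hF : IsLinearFunctor k F) {G : B ⥤ P}
    (hG : IsLinearFunctor k G) : IsLinearFunctor k (F ⋙ G) := by
  obtain ⟨_, _, _⟩ := hF
  obtain ⟨_, _, _⟩ := hG
  exact ⟨inferInstance, inferInstance, comp_preservesFiniteColimits F G⟩

/-- Postcomposition `G ↦ G ∘ box` of a functor of two variables with functors of one variable. -/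
def compBox {A B P : Type*} [Category* A] [Category* B] [Category* P] (box : A ⥤ B ⥤ P)
    (L : Type*) [Category* L] : (P ⥤ L) ⥤ (A ⥤ B ⥤ L) where
  obj G := box ⋙ (Functor.whiskeringRight B P L).obj G
  map τ := Functor.whiskerLeft box ((Functor.whiskeringRight B P L).map τ)

variable {k} in
lemma IsBilinearFunctor.compBox {box : A ⥤ B ⥤ P} (hbox : IsBilinearFunctor k box)
    {L : Type*} [Category* L] [Abelian L] [Linear k L] {G : P ⥤ L} (hG : IsLinearFunctor k G) :
    IsBilinearFunctor k ((FinTens.compBox box L).obj G) where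
  right a := (hbox.right a).comp k hG
  left b := (hbox.left b).comp k hG

/-- The functor `G ↦ G ∘ box` from linear functors `P ⥤ L` to bilinear functors `A × B ⥤ L`,
for a bilinear functor `box : A × B ⥤ P`. -/
def restrictAlongBox {box : A ⥤ B ⥤ P} (hbox : IsBilinearFunctor k box)
    (L : Type*) [Category* L] [Abelian L] [Linear k L] :
    (linearFunctors k P L).FullSubcategory ⥤ (bilinearFunctors k A B L).FullSubcategory :=
  (bilinearFunctors k A B L).lift ((linearFunctors k P L).ι ⋙ compBox box L)
    fun G => hbox.compBox G.property

end Deligne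

/-- `box : A × B ⥤ P` exhibits the linear category `P` as the Deligne product `A ⊠ B`: it is
bilinear and, for every linear category `L`, composition with `box` is an equivalence from the
category of linear functors `P ⥤ L` to the category of bilinear functors `A × B ⥤ L`. -/
structure IsDeligneProduct (k : Type*) [Field k] {A B : Type*} {P : Type w} [Category* A]
    [Abelian A] [Linear k A] [Category* B] [Abelian B] [Linear k B] [Category.{v} P] [Abelian P]
    [Linear k P] (box : A ⥤ B ⥤ P) : Prop where
  bilinear : IsBilinearFunctor k box
  isEquivalence (L : Type w) [Category.{v} L] [Abelian L] [Linear k L] :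
    (restrictAlongBox k bilinear L).IsEquivalence

section Action

variable {C D M N T P : Type*} [Category* C] [MonoidalCategory C] [Category* D]
  [MonoidalCategory D] [Category* T] [MonoidalCategory T] [Category* M] [MonoidalLeftAction C M]
  [Category* N] [MonoidalLeftAction D N] [Category* P] [MonoidalLeftAction T P]

open Functor.LaxMonoidal in
/-- Given functors `boxT : C × D ⥤ T`, monoidal for the componentwise monoidal structure of
`C × D`, and `boxP : M × N ⥤ P`, a structure on `boxP` of module functor over `boxT`, from the
componentwise action of `C × D` on `M × N` to the action of `T` on `P`: natural isomorphisms
`(c ⊠ d) ⊙ (m ⊠ n) ≅ (c ⊙ m) ⊠ (d ⊙ n)` compatible with associativity and units. -/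
structure BoxModuleStructure (boxT : C ⥤ D ⥤ T) [(Functor.uncurry.obj boxT).Monoidal]
    (boxP : M ⥤ N ⥤ P) where
  iso (c : C) (d : D) (m : M) (n : N) :
    (boxT.obj c).obj d ⊙ₗ (boxP.obj m).obj n ≅ (boxP.obj (c ⊙ₗ m)).obj (d ⊙ₗ n)
  naturality {c c' : C} {d d' : D} {m m' : M} {n n' : N} (f : c ⟶ c') (g : d ⟶ d')
    (h : m ⟶ m') (i : n ⟶ n') :
    ((Functor.uncurry.obj boxT).map (f ×ₘ g) ⊙ₗₘ (Functor.uncurry.obj boxP).map (h ×ₘ i)) ≫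
        (iso c' d' m' n').hom =
      (iso c d m n).hom ≫ (Functor.uncurry.obj boxP).map ((f ⊙ₗₘ h) ×ₘ (g ⊙ₗₘ i))
  associativity (c c' : C) (d d' : D) (m : M) (n : N) :
    μ (Functor.uncurry.obj boxT) (c, d) (c', d') ⊵ₗ ((boxP.obj m).obj n) ≫
        (iso (c ⊗ c') (d ⊗ d') m n).hom ≫
        (Functor.uncurry.obj boxP).map
          ((MonoidalLeftAction.actionAssocIso c c' m).hom ×ₘ
            (MonoidalLeftAction.actionAssocIso d d' n).hom) =
      (MonoidalLeftAction.actionAssocIso ((boxT.obj c).obj d) ((boxT.obj c').obj d')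
          ((boxP.obj m).obj n)).hom ≫
        (boxT.obj c).obj d ⊴ₗ (iso c' d' m n).hom ≫ (iso c d (c' ⊙ₗ m) (d' ⊙ₗ n)).hom
  unitality (m : M) (n : N) :
    ε (Functor.uncurry.obj boxT) ⊵ₗ ((boxP.obj m).obj n) ≫ (iso (𝟙_ C) (𝟙_ D) m n).hom ≫
        (Functor.uncurry.obj boxP).map
          ((MonoidalLeftAction.actionUnitIso (C := C) m).hom ×ₘ
            (MonoidalLeftAction.actionUnitIso (C := D) n).hom) =
      (MonoidalLeftAction.actionUnitIso (C := T) ((boxP.obj m).obj n)).hom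

end Action

end FinTens

/-!
# Deligne products of finite tensor categories and exact module categories

*Finiteness.* A finite linear category has a projective generator. Let `p` and `q` be projective
generators of two finite linear categories `A` and `B`. The functor
`(a, b) ↦ Hom(p, a) ⊗ Hom(q, b)` to finitely generated `End p ⊗ End q`-modules is bilinear, so it
factors through the Deligne product `A ⊠ B`. The induced functor is an equivalence
(`IsDeligneProduct.exists_equivalence`): its inverse is the functor `- ↦ (p ⊠ q) ⊗ -`, the partial
left adjoint of `Hom(p ⊠ q, -)`, and the two composites are compared with the identity by the
universal property and by the principle that a transformation of right exact functors is invertible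
as soon as it is so on a generator. Hence `p ⊠ q` is a projective generator with finite-dimensional
endomorphism algebra, which characterizes finite linear categories
(`Generates.isFiniteLinearCategory`).

*Simple objects.* Over a perfect field, every simple object of `A ⊠ B` is a retract of some `a ⊠ b`
(`IsDeligneProduct.exists_retract_box`). In module terms, let `X` be a simple module over `R ⊗ R'`
and let `S` be the image of `R` in the endomorphisms of `X`. The algebra `S` is simple, hence
separable since its center is a separable extension of the base field, and a separability element
of `S` splits the action map `S ⊗ X → X` by a map of `R ⊗ R'`-modules. This is the only use of
perfectness.

*Duals.* In `C ⊠ D` the objects `c ⊠ d` have duals, being images of dualizable objects under a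
monoidal functor. Any object `X` is a cokernel of a map `P₁ ⟶ P₀` between such objects, and the
kernel of the dual map `P₀ᘁ ⟶ P₁ᘁ` is a dual of `X` as soon as tensoring with `X` preserves that
kernel (`exists_rightDual_of_isColimit`). The latter holds because a monomorphism into a dualizable
object remains a monomorphism after tensoring with any object, by induction on the length of that
object, the case of a simple object being covered by the previous paragraph
(`IsBilinearFunctor.mono_map_app`).

*Exactness.* A projective `X` in `C ⊠ D` is a retract of a sum of copies of `p ⊠ q`, and
`(p ⊠ q) ⊙ (m ⊠ n) ≅ (p ⊙ m) ⊠ (q ⊙ n)` is projective, so `X ⊙ (m ⊠ n)` is projective. Simple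
objects being retracts of objects `m ⊠ n`, and the action of `X` being exact because `X` has a
dual, induction on the length shows that `X ⊙ y` is projective for all `y`
(`BoxModuleStructure.isExactAction`).
-/

namespace FinTens

attribute [local instance] Abelian.hasFiniteBiproducts

/-! ### Separability of simple algebras over perfect fields -/

section Separability

open scoped TensorProduct
open MulOpposite

/-- A separability element of a `k`-algebra `S`: an element `∑ aᵢ ⊗ bᵢ` of `S ⊗ Sᵐᵒᵖ` with
`∑ s aᵢ ⊗ bᵢ = ∑ aᵢ ⊗ bᵢ s` for all `s` and `∑ aᵢ bᵢ = 1`. -/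
structure IsSeparabilityElement (k S : Type*) [CommRing k] [Ring S] [Algebra k S]
    (e : S ⊗[k] Sᵐᵒᵖ) : Prop where
  comm (s : S) : (s ⊗ₜ 1) * e = ((1 : S) ⊗ₜ op s) * e
  mul_eq_one : AlgHom.mulLeftRight k S e 1 = 1

/-- A central simple algebra has a separability element: by the density theorem, `S ⊗ Sᵐᵒᵖ` acts on
`S` by all endomorphisms, and one can take the element acting as a projection onto the center. -/
lemma exists_isSeparabilityElement_of_isCentral (F S : Type*) [Field F] [Ring S] [Algebra F S]
    [Module.Finite F S] [IsSimpleRing S] [Algebra.IsCentral F S] :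
    ∃ e, IsSeparabilityElement F S e := by
  let _ : Module (S ⊗[F] Sᵐᵒᵖ) S := TensorProduct.Algebra.module
  have hsmul (r : S ⊗[F] Sᵐᵒᵖ) (x : S) : r • x = AlgHom.mulLeftRight F S r x := rfl
  have hsimple : IsSimpleModule (S ⊗[F] Sᵐᵒᵖ) S := by
    -- a submodule of `S` over `S ⊗ Sᵐᵒᵖ` is a two-sided ideal
    refine (isSimpleModule_iff _ _).2
      { exists_pair_ne := ⟨⊥, ⊤, bot_ne_top⟩, eq_bot_or_eq_top := fun N => ?_ }
    have hl (a x : S) (hx : x ∈ N) : a * x ∈ N := by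
      simpa [hsmul] using N.smul_mem (a ⊗ₜ 1) hx
    have hr (a x : S) (hx : x ∈ N) : x * a ∈ N := by
      simpa [hsmul] using N.smul_mem ((1 : S) ⊗ₜ op a) hx
    by_cases hN : N = ⊥
    · exact Or.inl hN
    obtain ⟨x, hx, hx₀⟩ := N.ne_bot_iff.1 hN
    let I : TwoSidedIdeal S := .mk' N N.zero_mem N.add_mem N.neg_mem (hl _ _) (hr _ _)
    have hI : I = ⊤ := (IsSimpleRing.simple.eq_bot_or_eq_top I).resolve_left fun h =>
      hx₀ (by simpa [h] using (show x ∈ I by simpa [I] using hx))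
    refine Or.inr (eq_top_iff.2 fun y _ => ?_)
    simpa [I] using (show y ∈ I from hI ▸ trivial)
  have hend (g : Module.End (S ⊗[F] Sᵐᵒᵖ) S) : ∃ c : F, ∀ x, g x = c • x := by
    have hl (a x : S) : g (a * x) = a * g x := by
      have := g.map_smul (a ⊗ₜ 1) x
      simpa [hsmul] using this
    have hr (a x : S) : g (x * a) = g x * a := by
      have := g.map_smul ((1 : S) ⊗ₜ op a) x
      simpa [hsmul] using this
    have hc : g 1 ∈ Subalgebra.center F S := Subalgebra.mem_center_iff.2 fun b => by
      rw [← hl, ← hr, mul_one, one_mul]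
    obtain ⟨c, hc⟩ := Algebra.IsCentral.mem_center_iff F |>.1 hc
    refine ⟨c, fun x => ?_⟩
    rw [← mul_one x, hl, hc, ← Algebra.commutes, Algebra.smul_def, mul_one]
  have hsurj : Function.Surjective (AlgHom.mulLeftRight F S) := by
    intro f
    let f' : Module.End (Module.End (S ⊗[F] Sᵐᵒᵖ) S) S :=
      { f with
        map_smul' := fun g x => by
          obtain ⟨c, hc⟩ := hend g
          change f (g x) = g (f x)
          rw [hc, hc, map_smul] }
    obtain ⟨s, hs⟩ := Module.Finite.fg_top (R := F) (M := S)
    obtain ⟨r, hr⟩ := jacobson_density f' s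
    refine ⟨r, LinearMap.ext_on hs fun x hx => (hr x hx).symm⟩
  have hinj : Function.Injective (AlgHom.mulLeftRight F S) := by
    refine (LinearMap.injective_iff_surjective_of_finrank_eq_finrank
      (f := (AlgHom.mulLeftRight F S).toLinearMap) ?_).2 hsurj
    rw [Module.finrank_tensorProduct, Module.finrank_linearMap,
      (opLinearEquiv F : S ≃ₗ[F] Sᵐᵒᵖ).finrank_eq]
  obtain ⟨π, hπ⟩ : ∃ π : S →ₗ[F] F, π 1 = 1 := by
    obtain ⟨π, hπ⟩ := LinearMap.exists_leftInverse_of_injective (Algebra.linearMap F S)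
      (LinearMap.ker_eq_bot.2 (algebraMap F S).injective)
    exact ⟨π, by simpa using LinearMap.congr_fun hπ 1⟩
  obtain ⟨e, he⟩ := hsurj ((Algebra.linearMap F S).comp π)
  refine ⟨e, ⟨fun s => hinj ?_, ?_⟩⟩
  · rw [map_mul, map_mul, he]
    ext x
    simp [Algebra.commutes]
  · rw [he]
    simp [hπ]

/-- Separability elements of `S` over `F` and of `F` over `k` yield one of `S` over `k`. -/
lemma exists_isSeparabilityElement_trans (k F S : Type*) [CommRing k] [CommRing F] [Algebra k F]
    [Ring S] [Algebra k S] [Algebra F S] [IsScalarTower k F S]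
    (hF : ∃ t : F ⊗[k] F, (∀ s, ((1 : F) ⊗ₜ[k] s - s ⊗ₜ[k] (1 : F)) * t = 0) ∧
      Algebra.TensorProduct.lmul' k t = 1)
    (hS : ∃ e, IsSeparabilityElement F S e) : ∃ e, IsSeparabilityElement k S e := by
  obtain ⟨t, ht, ht₁⟩ := hF
  obtain ⟨e, he⟩ := hS
  let ι : F ⊗[k] F →ₐ[k] S ⊗[k] Sᵐᵒᵖ :=
    Algebra.TensorProduct.map (IsScalarTower.toAlgHom k F S) (IsScalarTower.toAlgHom k F Sᵐᵒᵖ)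
  have hι (a b : F) : ι (a ⊗ₜ b) = algebraMap F S a ⊗ₜ op (algebraMap F S b) := rfl
  have hcomm (c : F) :
      (algebraMap F S c ⊗ₜ 1) * ι t = ((1 : S) ⊗ₜ op (algebraMap F S c)) * ι t := by
    have h := congr_arg ι (ht c)
    rw [map_mul, map_sub, hι, hι, map_zero, sub_mul, sub_eq_zero] at h
    simpa using h.symm
  have hone (y : S) : AlgHom.mulLeftRight k S (ι t) y = y := by
    have h (r : F ⊗[k] F) (y : S) : AlgHom.mulLeftRight k S (ι r) y =
        algebraMap F S (Algebra.TensorProduct.lmul' k r) * y := by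
      induction r with
      | zero => simp
      | tmul a b =>
        rw [hι, AlgHom.mulLeftRight_apply, unop_op, mul_assoc, ← Algebra.commutes, ← mul_assoc]
        simp
      | add r s hr hs => simp [hr, hs, add_mul]
    rw [h, ht₁, map_one, one_mul]
  -- right multiplication by `ι t` descends to the tensor product over `F`
  let Ψ : S ⊗[F] Sᵐᵒᵖ →+ S ⊗[k] Sᵐᵒᵖ :=
    TensorProduct.liftAddHom
      (AddMonoidHom.mk' (fun a => AddMonoidHom.mk' (fun b => (a ⊗ₜ b) * ι t)
        fun b b' => by rw [TensorProduct.tmul_add, add_mul])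
        fun a a' => by ext b; simp [TensorProduct.add_tmul, add_mul])
      fun c a b => by
        change ((c • a) ⊗ₜ b) * ι t = (a ⊗ₜ (c • b)) * ι t
        have h₁ : (c • a) ⊗ₜ[k] b = (a ⊗ₜ b) * (algebraMap F S c ⊗ₜ 1) := by
          rw [Algebra.TensorProduct.tmul_mul_tmul, mul_one, ← Algebra.commutes, ← Algebra.smul_def]
        have h₂ : a ⊗ₜ[k] (c • b) = (a ⊗ₜ b) * (1 ⊗ₜ op (algebraMap F S c)) := by
          rw [Algebra.TensorProduct.tmul_mul_tmul, mul_one]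
          congr 1
          rw [Algebra.smul_def, Algebra.commutes]
          rfl
        rw [h₁, h₂, mul_assoc, mul_assoc, hcomm]
  have hΨ (a : S) (b : Sᵐᵒᵖ) : Ψ (a ⊗ₜ b) = (a ⊗ₜ b) * ι t := rfl
  have hmul (a : S) (b : Sᵐᵒᵖ) (y : S ⊗[F] Sᵐᵒᵖ) :
      (a ⊗ₜ b) * Ψ y = Ψ ((a ⊗ₜ b) * y) := by
    induction y with
    | zero => simp
    | tmul c d =>
      rw [Algebra.TensorProduct.tmul_mul_tmul, hΨ, hΨ, ← mul_assoc,
        Algebra.TensorProduct.tmul_mul_tmul]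
    | add y z hy hz => rw [map_add, mul_add, mul_add, map_add, hy, hz]
  have happly (y : S ⊗[F] Sᵐᵒᵖ) :
      AlgHom.mulLeftRight k S (Ψ y) 1 = AlgHom.mulLeftRight F S y 1 := by
    induction y with
    | zero => simp
    | tmul c d =>
      rw [hΨ, map_mul, Module.End.mul_apply, hone]
      simp
    | add y z hy hz => simp [hy, hz]
  refine ⟨Ψ e, ⟨fun s => ?_, ?_⟩⟩
  · rw [hmul, hmul, he.comm]
  · rw [happly, he.mul_eq_one]

/-- The case of a simple algebra whose center is given as an abstract field `F`, which is separable
over the perfect field `k`. -/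
lemma exists_isSeparabilityElement_of_isCentral_tower (k F S : Type*) [Field k] [PerfectField k]
    [Field F] [Algebra k F] [Ring S] [Algebra k S] [Algebra F S] [IsScalarTower k F S]
    [Module.Finite k S] [IsSimpleRing S] [Algebra.IsCentral F S] :
    ∃ e, IsSeparabilityElement k S e := by
  have : Module.Finite k F := Module.Finite.of_injective (IsScalarTower.toAlgHom k F S).toLinearMap
    (algebraMap F S).injective
  have : Module.Finite F S := Module.Finite.of_restrictScalars_finite k _ _
  have : Algebra.FormallyUnramified k F := Algebra.FormallyUnramified.of_isSeparable k F
  exact exists_isSeparabilityElement_trans k F S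
    ⟨_, Algebra.FormallyUnramified.one_tmul_sub_tmul_one_mul_elem,
      Algebra.FormallyUnramified.lmul_elem⟩
    (exists_isSeparabilityElement_of_isCentral _ S)

/-- A finite-dimensional simple algebra over a perfect field has a separability element. -/
lemma exists_isSeparabilityElement (k S : Type*) [Field k] [PerfectField k] [Ring S] [Algebra k S]
    [Module.Finite k S] [IsSimpleRing S] : ∃ e, IsSeparabilityElement k S e := by
  have hZ : IsField (Subalgebra.center k S) := IsSimpleRing.isField_center S
  let _ : Field (Subalgebra.center k S) := hZ.toField
  let _ : Algebra (Subalgebra.center k S) S := (Subalgebra.center k S).val.toRingHom.toAlgebra'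
    fun c x => (Subalgebra.mem_center_iff.1 c.2 x).symm
  have htower : IsScalarTower k (Subalgebra.center k S) S := .of_algebraMap_eq fun _ => rfl
  have hcentral : Algebra.IsCentral (Subalgebra.center k S) S := ⟨fun x hx =>
    Algebra.mem_bot.2 ⟨⟨x, Subalgebra.mem_center_iff.2 (Subalgebra.mem_center_iff.1 hx)⟩, rfl⟩⟩
  exact @exists_isSeparabilityElement_of_isCentral_tower k (Subalgebra.center k S) S _ _ _ _ _ _ _
    htower _ _ hcentral

end Separability

/-! ### Generators and objects of finite length in abelian categories -/

section Generators

instance projective_biproduct_fin {T : Type*} [Category* T] [Abelian T] {n : ℕ} (f : Fin n → T)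
    [∀ i, Projective (f i)] : Projective (⨁ f) where
  factors {E X} g e _ :=
    ⟨biproduct.desc fun i => Projective.factorThru (biproduct.ι f i ≫ g) e, by ext; simp⟩

/-- A natural transformation which is invertible on a diagram is invertible on each of its colimits
that both functors preserve. -/
lemma isIso_app_of_isColimit {J K L : Type*} [Category* J] [Category* K] [Category* L]
    {F G : K ⥤ L} (τ : F ⟶ G) {D : J ⥤ K} {c : Cocone D} (hc : IsColimit c)
    [PreservesColimit D F] [PreservesColimit D G] (h : ∀ j, IsIso (τ.app (D.obj j))) :
    IsIso (τ.app c.pt) := by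
  have : ∀ j, IsIso ((Functor.whiskerLeft D τ).app j) := h
  have : IsIso (Functor.whiskerLeft D τ) := NatIso.isIso_of_isIso_app _
  let e := (isColimitOfPreserves F hc).coconePointsIsoOfNatIso (isColimitOfPreserves G hc)
    (asIso (Functor.whiskerLeft D τ))
  have he : τ.app c.pt = e.hom := by
    refine (isColimitOfPreserves F hc).hom_ext fun j => ?_
    rw [IsColimit.comp_coconePointsIsoOfNatIso_hom]
    simp
  rw [he]
  infer_instance

/-- `x` generates `T` if every object is a quotient of a finite direct sum of copies of `x`. -/
def Generates {T : Type*} [Category* T] [Abelian T] (x : T) : Prop :=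
  ∀ Y : T, ∃ (n : ℕ) (f : (⨁ fun _ : Fin n => x) ⟶ Y), Epi f

variable {T : Type*} [Category* T] [Abelian T] {x : T}

/-- Every object is a cokernel of a map between finite sums of copies of a generator. -/
lemma Generates.exists_presentation (hx : Generates x) (Y : T) :
    ∃ (m n : ℕ) (f : (⨁ fun _ : Fin m => x) ⟶ ⨁ fun _ : Fin n => x)
      (g : (⨁ fun _ : Fin n => x) ⟶ Y) (w : f ≫ g = 0),
      Nonempty (IsColimit (CokernelCofork.ofπ g w)) := by
  obtain ⟨n, g, hg⟩ := hx Y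
  obtain ⟨m, f, hf⟩ := hx (kernel g)
  exact ⟨m, n, f ≫ kernel.ι g, g, by simp,
    ⟨isCokernelEpiComp (Abelian.epiIsCokernelOfKernel _ (kernelIsKernel g)) f rfl⟩⟩

/-- A property of objects that is stable under finite colimits holds everywhere if it holds for a
generator. -/
lemma Generates.induction (hx : Generates x) {Q : T → Prop} (h0 : Q x)
    (hQ : ∀ {J : Type} [SmallCategory J] [FinCategory J] {D : J ⥤ T} {c : Cocone D},
      IsColimit c → (∀ j, Q (D.obj j)) → Q c.pt) (Y : T) : Q Y := by
  have hsum (n : ℕ) : Q (⨁ fun _ : Fin n => x) :=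
    hQ (biproduct.isColimit fun _ : Fin n => x) fun _ => h0
  obtain ⟨m, n, f, g, w, ⟨hc⟩⟩ := hx.exists_presentation Y
  exact hQ hc (by rintro (_ | _) <;> exact hsum _)

/-- A natural transformation of right exact functors is invertible if it is so on a generator. -/
lemma Generates.isIso_natTrans (hx : Generates x) {L : Type*} [Category* L] {F G : T ⥤ L}
    [PreservesFiniteColimits F] [PreservesFiniteColimits G] (τ : F ⟶ G) [IsIso (τ.app x)] :
    IsIso τ := by
  have (Y : T) : IsIso (τ.app Y) :=
    hx.induction (Q := fun Y => IsIso (τ.app Y)) inferInstance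
      (fun hc h => isIso_app_of_isColimit τ hc h) Y
  exact NatIso.isIso_of_isIso_app τ

/-- A natural transformation of functors of two variables which are right exact in each of them is
invertible if it is so on a pair of generators. -/
lemma Generates.isIso_natTrans₂ {A B L : Type*} [Category* A] [Abelian A] [Category* B] [Abelian B]
    [Category* L] {p : A} {q : B} (hp : Generates p) (hq : Generates q) {F G : A ⥤ B ⥤ L}
    (hF₁ : ∀ a, PreservesFiniteColimits (F.obj a))
    (hF₂ : ∀ b, PreservesFiniteColimits (F.flip.obj b))
    (hG₁ : ∀ a, PreservesFiniteColimits (G.obj a))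
    (hG₂ : ∀ b, PreservesFiniteColimits (G.flip.obj b)) (τ : F ⟶ G)
    [h : IsIso ((τ.app p).app q)] : IsIso τ := by
  let τq : F.flip.obj q ⟶ G.flip.obj q :=
    { app := fun a => (τ.app a).app q
      naturality := fun a a' f => congr_app (τ.naturality f) q }
  have : IsIso (τq.app p) := h
  have := hp.isIso_natTrans τq
  have (a : A) : IsIso (τ.app a) := by
    have : IsIso ((τ.app a).app q) := inferInstanceAs (IsIso (τq.app a))
    exact hq.isIso_natTrans (τ.app a)
  exact NatIso.isIso_of_isIso_app τ

/-- If `F` is additive and `F x` is projective for a generator `x`, then `F` sends projective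
objects to projective objects. -/
lemma Generates.projective_obj (hx : Generates x) {L : Type*} [Category* L] [Abelian L] (F : T ⥤ L)
    [F.Additive] [hFx : Projective (F.obj x)] (Y : T) [Projective Y] : Projective (F.obj Y) := by
  obtain ⟨n, f, _⟩ := hx Y
  have : PreservesFiniteBiproducts F := Functor.preservesFiniteBiproductsOfAdditive F
  have : Projective (F.obj (⨁ fun _ : Fin n => x)) :=
    have : Projective (⨁ fun _ : Fin n => F.obj x) := inferInstance
    Projective.of_iso (F.mapBiproduct fun _ : Fin n => x).symm this
  let r : Retract Y (⨁ fun _ : Fin n => x) :=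
    ⟨Projective.factorThru (𝟙 Y) f, f, Projective.factorThru_comp _ _⟩
  exact (r.map F).projective

end Generators

section FiniteLength

variable {T : Type*} [Category* T] [Abelian T]

/-- Induction on the length of an object. The proof is a Noetherian induction on the kernel of an
epimorphism `X ⟶ Y`, which grows when a simple subobject of `Y` is divided out. -/
lemma finiteLength_induction (hart : ∀ X : T, IsArtinianObject X) {Q : T → Prop}
    (hzero : ∀ X, IsZero X → Q X) (hsimple : ∀ X, Simple X → Q X)
    (hext : ∀ S : ShortComplex T, S.ShortExact → Q S.X₁ → Q S.X₃ → Q S.X₂)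
    (X : T) [IsNoetherianObject X] : Q X := by
  suffices H : ∀ (U : Subobject X) (Y : T) (g : X ⟶ Y) [Epi g], kernelSubobject g = U → Q Y from
    H _ X (𝟙 X) rfl
  intro U
  induction U using WellFoundedGT.induction with
  | ind U ih =>
    rintro Y g _ rfl
    have := hart Y
    by_cases hY : IsZero Y
    · exact hzero Y hY
    let S : ShortComplex T := ShortComplex.mk (simpleSubobjectArrow hY)
      (cokernel.π (simpleSubobjectArrow hY)) (by simp)
    have hS : S.ShortExact :=
      { exact := ShortComplex.exact_of_g_is_cokernel _ (cokernelIsCokernel _) }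
    refine hext S hS (hsimple _ inferInstance) (ih _ ?_ _ (g ≫ S.g) rfl)
    have hle : kernelSubobject g ≤ kernelSubobject (g ≫ S.g) := kernelSubobject_comp_le g S.g
    refine lt_of_le_of_ne hle fun heq => ?_
    have hfac : (kernelSubobject g).Factors (pullback.snd S.f g) := by
      rw [heq, kernelSubobject_factors_iff, ← Category.assoc, ← pullback.condition,
        Category.assoc, S.zero, comp_zero]
    rw [kernelSubobject_factors_iff, ← pullback.condition] at hfac
    have h0 : S.f = 0 := by
      rw [← cancel_epi (pullback.fst S.f g), hfac, comp_zero]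
    exact Simple.not_isZero (simpleSubobject hY) (IsZero.of_mono_eq_zero S.f h0)

end FiniteLength

section FiniteLinear

variable (k : Type*) [Field k] {T : Type*} [Category* T] [Abelian T] [Linear k T]

/-- A finite linear category has a projective generator. -/
lemma IsFiniteLinearCategory.exists_projective_generates (hT : IsFiniteLinearCategory k T) :
    ∃ p : T, Projective p ∧ Generates p := by
  have := hT.enoughProjectives
  have := hT.noetherian
  obtain ⟨n, S, hS⟩ := hT.finitely_many_simples
  let p : T := ⨁ fun i => Projective.over (S i)
  refine ⟨p, inferInstance, fun Y => ?_⟩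
  refine finiteLength_induction (Q := fun Y => ∃ (n : ℕ) (f : (⨁ fun _ : Fin n => p) ⟶ Y), Epi f)
    hT.artinian (fun X hX => ⟨0, 0, hX.epi _⟩) (fun X hX => ?_) (fun E hE h₁ h₃ => ?_) Y
  · obtain ⟨i, ⟨e⟩⟩ := hS X hX
    let a : (⨁ fun _ : Fin 1 => p) ⟶ p := biproduct.π _ 0
    let b : p ⟶ Projective.over (S i) := biproduct.π _ i
    have : Epi a := (inferInstance : IsSplitEpi a).epi
    have : Epi b := (inferInstance : IsSplitEpi b).epi
    exact ⟨1, a ≫ b ≫ Projective.π (S i) ≫ e.inv, inferInstance⟩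
  · obtain ⟨n₁, f₁, _⟩ := h₁
    obtain ⟨n₃, f₃, _⟩ := h₃
    have := hE.epi_g
    let l := Projective.factorThru f₃ E.g
    have hl : l ≫ E.g = f₃ := Projective.factorThru_comp _ _
    let F : (⨁ fun _ : Fin (n₁ + n₃) => p) ⟶ E.X₂ := biproduct.desc fun j =>
      Fin.addCases (motive := fun _ => p ⟶ E.X₂)
        (fun i => biproduct.ι (fun _ : Fin n₁ => p) i ≫ f₁ ≫ E.f)
        (fun i => biproduct.ι (fun _ : Fin n₃ => p) i ≫ l) j
    refine ⟨n₁ + n₃, F, Preadditive.epi_of_cancel_zero _ fun {Z} g hg => ?_⟩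
    have hg' : ∀ j, biproduct.ι _ j ≫ F ≫ g = 0 := fun j => by rw [hg, comp_zero]
    have hfg : f₁ ≫ E.f ≫ g = 0 := by
      refine biproduct.hom_ext' _ _ fun i => ?_
      simpa [F] using hg' (Fin.castAdd n₃ i)
    have hlg : l ≫ g = 0 := by
      refine biproduct.hom_ext' _ _ fun i => ?_
      simpa [F] using hg' (Fin.natAdd n₁ i)
    have hfg' : E.f ≫ g = 0 := by rw [← cancel_epi f₁, hfg, comp_zero]
    obtain ⟨t, rfl⟩ := hE.exact.desc' g hfg'
    have : t = 0 := by rw [← cancel_epi f₃, ← hl, Category.assoc, hlg, comp_zero]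
    rw [this, comp_zero]

variable {k}

/-- Hom spaces out of a generator detect inclusions of subobjects. -/
lemma Generates.le_of_forall_factors {x : T} (hx : Generates x) {Y : T} {U V : Subobject Y}
    (h : ∀ f : x ⟶ Y, U.Factors f → V.Factors f) : U ≤ V := by
  obtain ⟨n, g, _⟩ := hx (U : T)
  have hz : U.arrow ≫ cokernel.π V.arrow = 0 := by
    rw [← cancel_epi g]
    refine biproduct.hom_ext' _ _ fun i => ?_
    have hi : V.Factors ((biproduct.ι _ i ≫ g) ≫ U.arrow) :=
      h _ (Subobject.factors_comp_arrow _)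
    have := Subobject.factorThru_arrow _ _ hi
    simp only [Category.assoc] at this
    rw [reassoc_of% this.symm]
    simp
  have hl := (Abelian.monoIsKernelOfCokernel _ (cokernelIsCokernel V.arrow)).fac
    (KernelFork.ofι U.arrow hz) WalkingParallelPair.zero
  exact Subobject.le_of_comm _ hl

variable (k) in
/-- The space of morphisms out of `x` which factor through a given subobject. -/
def factoringSubmodule (x : T) {Y : T} (U : Subobject Y) : Submodule k (x ⟶ Y) where
  carrier := {f | U.Factors f}
  add_mem' hf hg := Subobject.factors_add _ _ hf hg
  zero_mem' := Subobject.factors_zero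
  smul_mem' c f hf := by
    refine Subobject.factors_of_factors_right (P := U) (c • 𝟙 x) hf |> fun h => ?_
    simpa using h

lemma Generates.factoringSubmodule_strictMono {x : T} (hx : Generates x) (Y : T) :
    StrictMono (factoringSubmodule k x (Y := Y)) := by
  refine Monotone.strictMono_of_injective (fun U V hUV f hf => Subobject.factors_of_le f hUV hf)
    fun U V hUV => ?_
  exact le_antisymm
    (hx.le_of_forall_factors fun f hf => (SetLike.ext_iff.1 hUV f).1 hf)
    (hx.le_of_forall_factors fun f hf => (SetLike.ext_iff.1 hUV f).2 hf)

/-- A linear category is finite if it has a projective generator with finite-dimensional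
endomorphism algebra. -/
lemma Generates.isFiniteLinearCategory {x : T} (hx : Generates x) [Projective x]
    [Module.Finite k (x ⟶ x)] : IsFiniteLinearCategory k T := by
  have hfin₁ (Y : T) : Module.Finite k (x ⟶ Y) := by
    obtain ⟨n, f, _⟩ := hx Y
    let φ : (Fin n → (x ⟶ x)) →ₗ[k] (x ⟶ Y) :=
      { toFun := fun a => biproduct.lift a ≫ f
        map_add' := fun a b => by
          rw [← Preadditive.add_comp]; congr 1; ext; simp
        map_smul' := fun c a => by
          rw [RingHom.id_apply, ← Linear.smul_comp]; congr 1; ext; simp }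
    refine Module.Finite.of_surjective φ fun g => ?_
    refine ⟨fun i => Projective.factorThru g f ≫ biproduct.π _ i, ?_⟩
    have : biproduct.lift (fun i => Projective.factorThru g f ≫ biproduct.π _ i) =
        Projective.factorThru g f := by ext; simp
    change biproduct.lift _ ≫ f = g
    rw [this, Projective.factorThru_comp]
  have hfin (X Y : T) : Module.Finite k (X ⟶ Y) := by
    obtain ⟨n, f, _⟩ := hx X
    let φ : (X ⟶ Y) →ₗ[k] (Fin n → (x ⟶ Y)) :=
      LinearMap.pi fun i =>
      Linear.leftComp k Y (biproduct.ι (fun _ : Fin n => x) i ≫ f)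
    refine Module.Finite.of_injective φ ((injective_iff_map_eq_zero φ).2 fun g hg => ?_)
    rw [← cancel_epi f, comp_zero]
    refine biproduct.hom_ext' _ _ fun i => ?_
    simpa [φ] using congr_fun hg i
  have hart (Y : T) : IsArtinianObject Y := by
    have : WellFoundedLT (Subobject Y) :=
      (hx.factoringSubmodule_strictMono (k := k) Y).wellFoundedLT
    exact ⟨this⟩
  have hnoeth (Y : T) : IsNoetherianObject Y := by
    have : WellFoundedGT (Subobject Y) :=
      (hx.factoringSubmodule_strictMono (k := k) Y).wellFoundedGT
    exact ⟨this⟩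
  -- the simple quotients of `x` are among the finitely many composition factors of `x`
  have hsimples : ∃ (n : ℕ) (S : Fin n → T), ∀ Z : T, Simple Z → (∃ f : x ⟶ Z, f ≠ 0) →
      ∃ i, Nonempty (Z ≅ S i) := by
    refine finiteLength_induction (Q := fun Y => ∃ (n : ℕ) (S : Fin n → T), ∀ Z : T, Simple Z →
      (∃ f : Y ⟶ Z, f ≠ 0) → ∃ i, Nonempty (Z ≅ S i)) hart
      (fun Y hY => ⟨0, Fin.elim0, fun Z _ ⟨f, hf⟩ => (hf (hY.eq_of_src _ _)).elim⟩)
      (fun Y _ => ⟨1, fun _ => Y, fun Z _ ⟨f, hf⟩ =>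
        have := isIso_of_hom_simple hf
        ⟨0, ⟨(asIso f).symm⟩⟩⟩) ?_ x
    rintro E hE ⟨n₁, S₁, h₁⟩ ⟨n₃, S₃, h₃⟩
    refine ⟨n₁ + n₃, Fin.addCases S₁ S₃, fun Z hZ ⟨f, hf⟩ => ?_⟩
    by_cases h0 : E.f ≫ f = 0
    · have := hE.epi_g
      obtain ⟨t, rfl⟩ := hE.exact.desc' f h0
      obtain ⟨i, hi⟩ := h₃ Z hZ ⟨t, by rintro rfl; simp at hf⟩
      exact ⟨Fin.natAdd n₁ i, by simpa using hi⟩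
    · obtain ⟨i, hi⟩ := h₁ Z hZ ⟨_, h0⟩
      exact ⟨Fin.castAdd n₃ i, by simpa using hi⟩
  refine ⟨hfin, hart, hnoeth, ⟨fun X => ?_⟩, ?_⟩
  · obtain ⟨n, f, _⟩ := hx X
    exact ⟨⟨_, f⟩⟩
  · obtain ⟨n, S, hS⟩ := hsimples
    refine ⟨n, S, fun Z hZ => hS Z hZ ?_⟩
    by_contra! h
    obtain ⟨m, f, _⟩ := hx Z
    refine Simple.not_isZero Z (IsZero.of_epi_eq_zero f (biproduct.hom_ext' _ _ fun i => ?_))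
    rw [comp_zero]
    exact h _

end FiniteLinear

/-! ### Hom functors and their partial left adjoints on finitely generated modules -/

section RegularModule

variable (R : Type v) [Ring R] [IsNoetherianRing R]

lemma fgModuleCat_epi_iff {M N : FGModuleCat.{v} R} (f : M ⟶ N) :
    Epi f ↔ Function.Surjective f.hom.hom := by
  rw [← ModuleCat.epi_iff_surjective]
  exact ((forget₂ (FGModuleCat.{v} R) (ModuleCat.{v} R)).epi_map_iff_epi f).symm

lemma fgModuleCat_mono_iff {M N : FGModuleCat.{v} R} (f : M ⟶ N) :
    Mono f ↔ Function.Injective f.hom.hom := by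
  rw [← ModuleCat.mono_iff_injective]
  exact ((forget₂ (FGModuleCat.{v} R) (ModuleCat.{v} R)).mono_map_iff_mono f).symm

instance fgModuleCat_projective_regular : Projective (FGModuleCat.of R R) where
  factors {E X} f e he := by
    obtain ⟨y, hy⟩ := (fgModuleCat_epi_iff R e).1 he (f.hom.hom 1)
    refine ⟨FGModuleCat.ofHom (LinearMap.toSpanSingleton R E y), ?_⟩
    ext
    change e.hom.hom ((1 : R) • y) = f.hom.hom 1
    rw [one_smul, hy]

lemma fgModuleCat_generates_regular : Generates (FGModuleCat.of R R) := by
  intro M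
  obtain ⟨n, s, hs⟩ := Module.Finite.exists_fin (R := R) (M := M)
  let f : (⨁ fun _ : Fin n => FGModuleCat.of R R) ⟶ M :=
    biproduct.desc fun i => FGModuleCat.ofHom (LinearMap.toSpanSingleton R M (s i))
  refine ⟨n, f, (fgModuleCat_epi_iff R f).2 ?_⟩
  rw [← LinearMap.range_eq_top, eq_top_iff, ← hs, Submodule.span_le]
  rintro _ ⟨i, rfl⟩
  refine ⟨(biproduct.ι (fun _ : Fin n => FGModuleCat.of R R) i).hom.hom (1 : R), ?_⟩
  have h : biproduct.ι (fun _ : Fin n => FGModuleCat.of R R) i ≫ f =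
    FGModuleCat.ofHom (LinearMap.toSpanSingleton R M (s i)) := biproduct.ι_desc _ _
  have h' := congr_arg (fun g => g.hom.hom (1 : R)) h
  refine h'.trans ?_
  change (1 : R) • s i = s i
  rw [one_smul]

end RegularModule

section PartialAdjoint

variable {k : Type*} [Field k] {T : Type*} [Category.{v} T] [Abelian T] [Linear k T] {x : T}
  {R : Type v} [Ring R] [Algebra k R] (φ : R →ₐ[k] (End x)ᵐᵒᵖ)

/-- A linear map between bundled modules, as a morphism between these very objects. -/
def homOfLinear {S : Type v} [Ring S] {M N : ModuleCat.{v} S} (f : M →ₗ[S] N) : M ⟶ N :=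
  ModuleCat.ofHom f

/-- The functor `Hom(x, -)` with values in modules over an algebra acting on `x` (from the right,
so that it acts on `Hom(x, -)` from the left). -/
noncomputable def homModule : T ⥤ ModuleCat.{v} R :=
  preadditiveCoyonedaObj x ⋙ ModuleCat.restrictScalars φ.toRingHom

instance : (homModule φ).Additive := by
  unfold homModule
  infer_instance

instance [Projective x] : PreservesFiniteColimits (homModule φ) :=
  comp_preservesFiniteColimits _ _

/-- The morphism `x ⟶ t` underlying an element of the module `Hom(x, t)`. -/
noncomputable def homModuleElt {t : T} : (homModule φ).obj t ≃+ (x ⟶ t) := AddEquiv.refl _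

lemma homModuleElt_smul {t : T} (r : R) (f : (homModule φ).obj t) :
    homModuleElt φ (r • f) = (φ r).unop ≫ homModuleElt φ f := rfl

lemma homModuleElt_map {t t' : T} (g : t ⟶ t') (f : (homModule φ).obj t) :
    homModuleElt φ ((homModule φ).map g f) = homModuleElt φ f ≫ g := rfl

instance : (homModule φ).Linear k where
  map_smul {X Y} f c := by
    ext g
    apply (homModuleElt φ).injective
    change homModuleElt φ ((homModule φ).map (c • f) g) =
      homModuleElt φ (algebraMap k R c • (homModule φ).map f g)
    rw [homModuleElt_smul, homModuleElt_map, homModuleElt_map, AlgHom.commutes]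
    change _ = (c • 𝟙 x) ≫ _
    simp

/-- Maps from the regular module to `Hom(x, t)` correspond to morphisms `x ⟶ t`. -/
noncomputable def regularHomEquiv {t : T} :
    (x ⟶ t) ≃ (ModuleCat.of R R ⟶ (homModule φ).obj t) where
  toFun f := homOfLinear (M := ModuleCat.of R R)
    (LinearMap.toSpanSingleton R ((homModule φ).obj t) ((homModuleElt φ).symm f))
  invFun g := homModuleElt φ (g.hom (1 : R))
  left_inv f := by
    change homModuleElt φ ((1 : R) • (homModuleElt φ).symm f) = f
    simp
  right_inv g := by
    ext
    change (1 : R) • g.hom (1 : R) = g.hom (1 : R)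
    rw [one_smul]

lemma regularHomEquiv_comp {t t' : T} (f : x ⟶ t) (g : t ⟶ t') :
    regularHomEquiv φ (f ≫ g) = regularHomEquiv φ f ≫ (homModule φ).map g := by
  ext
  apply (homModuleElt φ).injective
  change homModuleElt φ ((1 : R) • (homModuleElt φ).symm (f ≫ g)) =
    homModuleElt φ ((homModule φ).map g ((1 : R) • (homModuleElt φ).symm f))
  rw [one_smul, one_smul, homModuleElt_map]
  simp

/-- `x` corepresents maps from the regular module to `Hom(x, -)`. -/
noncomputable def corepresentableByRegular :
    (homModule φ ⋙ coyoneda.obj (Opposite.op (ModuleCat.of R R))).CorepresentableBy x where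
  homEquiv := regularHomEquiv φ
  homEquiv_comp g f := regularHomEquiv_comp φ f g

variable [IsNoetherianRing R]

/-- `Hom(x, -)` has a partial left adjoint on finitely generated modules: it is defined on the
regular module, and the modules on which it is defined are stable under finite colimits. -/
lemma leftAdjointObjIsDefined_homModule (M : FGModuleCat.{v} R) :
    (homModule φ).leftAdjointObjIsDefined M.obj := by
  refine (fgModuleCat_generates_regular R).induction
    (Q := fun M => (homModule φ).leftAdjointObjIsDefined M.obj)
    (corepresentableByRegular φ).isCorepresentable (fun {J _ _ D c} hc h => ?_) M
  exact Functor.leftAdjointObjIsDefined_of_isColimit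
    (isColimitOfPreserves (forget₂ (FGModuleCat.{v} R) (ModuleCat.{v} R)) hc) h

/-- The functor `M ↦ x ⊗[R] M` on finitely generated modules, defined as the partial left adjoint of
`Hom(x, -)`. -/
noncomputable def tensorGen : FGModuleCat.{v} R ⥤ T :=
  (homModule φ).leftAdjointObjIsDefined.lift (ModuleCat.isFG R).ι
    (leftAdjointObjIsDefined_homModule φ) ⋙ (homModule φ).partialLeftAdjoint

/-- The adjunction bijection defining `tensorGen`. -/
noncomputable def tensorGenEquiv {M : FGModuleCat.{v} R} {t : T} :
    ((tensorGen φ).obj M ⟶ t) ≃ (M.obj ⟶ (homModule φ).obj t) :=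
  (homModule φ).partialLeftAdjointHomEquiv
    (X := ⟨M.obj, leftAdjointObjIsDefined_homModule φ M⟩)

lemma tensorGenEquiv_comp {M : FGModuleCat.{v} R} {t t' : T} (f : (tensorGen φ).obj M ⟶ t)
    (g : t ⟶ t') :
    tensorGenEquiv φ (f ≫ g) = tensorGenEquiv φ f ≫ (homModule φ).map g :=
  (homModule φ).partialLeftAdjointHomEquiv_comp _ _

lemma tensorGenEquiv_map_comp {M M' : FGModuleCat.{v} R} {t : T} (f : M ⟶ M')
    (g : (tensorGen φ).obj M' ⟶ t) :
    tensorGenEquiv φ ((tensorGen φ).map f ≫ g) = f.hom ≫ tensorGenEquiv φ g :=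
  (homModule φ).partialLeftAdjointHomEquiv_map_comp
    (X := ⟨M.obj, leftAdjointObjIsDefined_homModule φ M⟩)
    (X' := ⟨M'.obj, leftAdjointObjIsDefined_homModule φ M'⟩) (ObjectProperty.homMk f.hom) g

/-- The unit of the partial adjunction. -/
noncomputable def tensorGenUnit :
    (ModuleCat.isFG.{v} R).ι ⟶ tensorGen φ ⋙ homModule φ where
  app M := tensorGenEquiv φ (𝟙 _)
  naturality M M' f := by
    change f.hom ≫ _ = _ ≫ (homModule φ).map ((tensorGen φ).map f)
    rw [← tensorGenEquiv_map_comp, ← tensorGenEquiv_comp, Category.comp_id, Category.id_comp]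

lemma tensorGenEquiv_eq {M : FGModuleCat.{v} R} {t : T} (f : (tensorGen φ).obj M ⟶ t) :
    tensorGenEquiv φ f = (tensorGenUnit φ).app M ≫ (homModule φ).map f := by
  change _ = tensorGenEquiv φ (𝟙 _) ≫ _
  rw [← tensorGenEquiv_comp, Category.id_comp]

lemma tensorGenEquiv_add {M : FGModuleCat.{v} R} {t : T} (f g : (tensorGen φ).obj M ⟶ t) :
    tensorGenEquiv φ (f + g) = tensorGenEquiv φ f + tensorGenEquiv φ g := by
  simp only [tensorGenEquiv_eq, Functor.map_add, Preadditive.comp_add]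

lemma tensorGenEquiv_smul {M : FGModuleCat.{v} R} {t : T} (c : k) (f : (tensorGen φ).obj M ⟶ t) :
    tensorGenEquiv φ (c • f) = c • tensorGenEquiv φ f := by
  simp only [tensorGenEquiv_eq, Functor.map_smul, Linear.comp_smul]

lemma tensorGenEquiv_map {M M' : FGModuleCat.{v} R} (f : M ⟶ M') :
    tensorGenEquiv φ ((tensorGen φ).map f) = f.hom ≫ (tensorGenUnit φ).app M' := by
  rw [← Category.comp_id ((tensorGen φ).map f), tensorGenEquiv_map_comp]
  rfl

instance : (tensorGen φ).Additive where
  map_add {M M' f g} := by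
    apply (tensorGenEquiv φ).injective
    rw [tensorGenEquiv_add, tensorGenEquiv_map, tensorGenEquiv_map, tensorGenEquiv_map,
      ← Preadditive.add_comp]
    rfl

instance : (tensorGen φ).Linear k where
  map_smul {M M'} f c := by
    apply (tensorGenEquiv φ).injective
    rw [tensorGenEquiv_smul, tensorGenEquiv_map, tensorGenEquiv_map, ← Linear.smul_comp]
    rfl

instance : PreservesFiniteColimits (tensorGen φ) where
  preservesFiniteColimits J _ _ := ⟨fun {D} => ⟨fun {c} hc => ⟨by
    have hc' := isColimitOfPreserves (forget₂ (FGModuleCat.{v} R) (ModuleCat.{v} R)) hc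
    let cc (s : Cocone (D ⋙ tensorGen φ)) :
        Cocone (D ⋙ forget₂ (FGModuleCat.{v} R) (ModuleCat.{v} R)) :=
      { pt := (homModule φ).obj s.pt
        ι :=
          { app := fun j => tensorGenEquiv φ (s.ι.app j)
            naturality := fun i j f => by
              refine ((tensorGenEquiv_map_comp φ (D.map f) (s.ι.app j)).symm.trans ?_).trans
                (Category.comp_id _).symm
              congr 1
              exact s.w f } }
    exact
      { desc := fun s => (tensorGenEquiv φ).symm (hc'.desc (cc s))
        fac := fun s j => by
          apply (tensorGenEquiv φ).injective
          refine (tensorGenEquiv_map_comp φ (c.ι.app j) _).trans ?_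
          rw [Equiv.apply_symm_apply]
          exact hc'.fac (cc s) j
        uniq := fun s m hm => by
          rw [Equiv.eq_symm_apply]
          refine hc'.hom_ext fun j => ?_
          rw [hc'.fac (cc s) j]
          refine (tensorGenEquiv_map_comp φ (c.ι.app j) m).symm.trans ?_
          exact congr_arg _ (hm j) }⟩⟩⟩

lemma isLinearFunctor_tensorGen : IsLinearFunctor k (tensorGen φ) :=
  ⟨inferInstance, inferInstance, inferInstance⟩

/-- `tensorGen` sends the regular module to `x`. -/
noncomputable def tensorGenRegularIso : (tensorGen φ).obj (FGModuleCat.of R R) ≅ x where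
  hom := (tensorGenEquiv φ).symm (regularHomEquiv φ (𝟙 x))
  inv := (regularHomEquiv φ).symm (tensorGenEquiv φ (M := FGModuleCat.of R R) (𝟙 _))
  hom_inv_id := by
    apply (tensorGenEquiv φ).injective
    rw [tensorGenEquiv_comp, Equiv.apply_symm_apply, ← regularHomEquiv_comp, Category.id_comp,
      Equiv.apply_symm_apply]
  inv_hom_id := by
    apply (regularHomEquiv φ).injective
    rw [regularHomEquiv_comp, Equiv.apply_symm_apply, ← tensorGenEquiv_comp, Category.id_comp,
      Equiv.apply_symm_apply]

lemma tensorGenUnit_regular :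
    (tensorGenUnit φ).app (FGModuleCat.of R R) ≫
      (homModule φ).map (tensorGenRegularIso φ).hom = regularHomEquiv φ (𝟙 x) := by
  rw [← tensorGenEquiv_eq]
  exact Equiv.apply_symm_apply _ _

/-- The unit is invertible if `x` is projective with endomorphism algebra `R`: this is the essential
surjectivity half of Morita theory. -/
lemma isIso_tensorGenUnit [Projective x] (hφ : Function.Bijective φ) :
    IsIso (tensorGenUnit φ) := by
  have : PreservesFiniteColimits (ModuleCat.isFG.{v} R).ι :=
    inferInstanceAs (PreservesFiniteColimits (forget₂ (FGModuleCat.{v} R) (ModuleCat.{v} R)))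
  have : PreservesFiniteColimits (tensorGen φ ⋙ homModule φ) :=
    comp_preservesFiniteColimits _ _
  have h : IsIso (regularHomEquiv φ (𝟙 x)) := by
    refine (ConcreteCategory.isIso_iff_bijective _).2 ?_
    have hb : Function.Bijective fun r : R => (φ r).unop ≫ 𝟙 x := by
      simpa using! MulOpposite.unop_bijective.comp hφ
    exact hb
  rw [← tensorGenUnit_regular] at h
  have : IsIso ((tensorGenUnit φ).app (FGModuleCat.of R R)) := IsIso.of_isIso_comp_right _
    ((homModule φ).map (tensorGenRegularIso φ).hom)
  exact (fgModuleCat_generates_regular R).isIso_natTrans _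

end PartialAdjoint

/-! ### External tensor products of modules -/

section ExternalTensor

open scoped TensorProduct ModuleCat

variable {k : Type v} [Field k] {A B : Type v} [Ring A] [Algebra k A] [Ring B] [Algebra k B]

section Module

variable (A B) (M N : Type v) [AddCommGroup M] [Module k M] [Module A M] [IsScalarTower k A M]
  [AddCommGroup N] [Module k N] [Module B N] [IsScalarTower k B N]

/-- The action of `A ⊗ B` on `M ⊗ N` for an `A`-module `M` and a `B`-module `N`. -/
noncomputable def externalAction : A ⊗[k] B →ₐ[k] Module.End k (M ⊗[k] N) :=
  (Module.endTensorEndAlgHom (R := k) (A := k) (M := M) (N := N)).comp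
    (Algebra.TensorProduct.map (Algebra.lsmul k k M) (Algebra.lsmul k k N))

/-- The external tensor product of an `A`-module and a `B`-module, as an `A ⊗ B`-module. -/
@[reducible]
noncomputable def externalModule : Module (A ⊗[k] B) (M ⊗[k] N) :=
  Module.compHom _ (externalAction A B M N).toRingHom

end Module

attribute [local instance] externalModule

section Module

variable {M N : Type v} [AddCommGroup M] [Module k M] [Module A M] [IsScalarTower k A M]
  [AddCommGroup N] [Module k N] [Module B N] [IsScalarTower k B N]

lemma external_smul_tmul (a : A) (b : B) (m : M) (n : N) :
    (a ⊗ₜ[k] b) • (m ⊗ₜ[k] n) = (a • m) ⊗ₜ[k] (b • n) := rfl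

instance : IsScalarTower k (A ⊗[k] B) (M ⊗[k] N) where
  smul_assoc c r y := by
    change externalAction A B M N (c • r) y = c • externalAction A B M N r y
    rw [map_smul]
    rfl

/-- Linearity over `A ⊗ B` can be checked on pure tensors. -/
lemma map_smul_of_tmul {X Y : Type v} [AddCommGroup X] [Module (A ⊗[k] B) X] [AddCommGroup Y]
    [Module (A ⊗[k] B) Y] (f : X →+ Y)
    (h : ∀ (a : A) (b : B) (y : X), f ((a ⊗ₜ[k] b) • y) = (a ⊗ₜ[k] b) • f y)
    (r : A ⊗[k] B) (y : X) : f (r • y) = r • f y := by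
  induction r with
  | zero => simp
  | tmul a b => exact h a b y
  | add r s hr hs => rw [add_smul, map_add, hr, hs, add_smul]

variable {M' N' : Type v} [AddCommGroup M'] [Module k M'] [Module A M'] [IsScalarTower k A M']
  [AddCommGroup N'] [Module k N'] [Module B N'] [IsScalarTower k B N']

/-- The external tensor product of linear maps. -/
noncomputable def externalMap (f : M →ₗ[A] M') (g : N →ₗ[B] N') :
    M ⊗[k] N →ₗ[A ⊗[k] B] M' ⊗[k] N' :=
  { TensorProduct.map (f.restrictScalars k) (g.restrictScalars k) with
    map_smul' := map_smul_of_tmul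
      (TensorProduct.map (f.restrictScalars k) (g.restrictScalars k)).toAddMonoidHom
      fun a b y => by
        induction y with
        | zero => simp
        | tmul m n =>
          change f (a • m) ⊗ₜ[k] g (b • n) = (a • f m) ⊗ₜ[k] (b • g n)
          rw [map_smul, map_smul]
        | add y z hy hz => rw [smul_add, map_add, map_add, smul_add, hy, hz] }

lemma external_hom_ext {X : Type v} [AddCommGroup X] [Module (A ⊗[k] B) X]
    {f g : M ⊗[k] N →ₗ[A ⊗[k] B] X} (h : ∀ m n, f (m ⊗ₜ[k] n) = g (m ⊗ₜ[k] n)) : f = g := by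
  ext y
  induction y with
  | zero => simp
  | tmul m n => exact h m n
  | add y z hy hz => rw [map_add, map_add, hy, hz]

instance [Module.Finite k A] [Module.Finite k B] [Module.Finite A M] [Module.Finite B N] :
    Module.Finite (A ⊗[k] B) (M ⊗[k] N) := by
  have : Module.Finite k M := Module.Finite.trans A M
  have : Module.Finite k N := Module.Finite.trans B N
  exact Module.Finite.of_restrictScalars_finite k _ _

end Module

/-- If `M` and `N` are free on `m` and `n`, then `M ⊗ N` is free on `m ⊗ n`. -/
lemma bijective_toSpanSingleton_tmul {M N : Type v} [AddCommGroup M] [Module k M] [Module A M]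
    [IsScalarTower k A M] [AddCommGroup N] [Module k N] [Module B N] [IsScalarTower k B N]
    {m : M} {n : N} (hm : Function.Bijective fun a : A => a • m)
    (hn : Function.Bijective fun b : B => b • n) :
    Function.Bijective fun r : A ⊗[k] B => r • (m ⊗ₜ[k] n) := by
  let em : A ≃ₗ[k] M :=
    LinearEquiv.ofBijective ((LinearMap.toSpanSingleton A M m).restrictScalars k) hm
  let en : B ≃ₗ[k] N :=
    LinearEquiv.ofBijective ((LinearMap.toSpanSingleton B N n).restrictScalars k) hn
  convert (TensorProduct.congr em en).bijective using 1
  ext r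
  induction r with
  | zero => simp
  | tmul a b => rfl
  | add r s hr hs => rw [add_smul, map_add, hr, hs]

lemma fgModuleCat_exact_iff [IsNoetherianRing A] (S : ShortComplex (FGModuleCat.{v} A)) :
    S.Exact ↔ Function.Exact S.f.hom.hom S.g.hom.hom := by
  rw [← S.exact_map_iff_of_faithful (forget₂ (FGModuleCat.{v} A) (ModuleCat.{v} A)),
    ShortComplex.ShortExact.moduleCat_exact_iff_function_exact]
  rfl

variable (k A B) [Module.Finite k A] [Module.Finite k B]

/-- The external tensor product of finitely generated modules over finite-dimensional algebras, as a
functor of two variables. -/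
noncomputable def externalTensor : FGModuleCat.{v} A ⥤ FGModuleCat.{v} B ⥤
    FGModuleCat.{v} (A ⊗[k] B) where
  obj M :=
    { obj N := FGModuleCat.of (A ⊗[k] B) (M ⊗[k] N)
      map g := FGModuleCat.ofHom (externalMap LinearMap.id g.hom.hom)
      map_id N := by ext1; exact external_hom_ext fun m n => rfl
      map_comp g h := by ext1; exact external_hom_ext fun m n => rfl }
  map f :=
    { app N := FGModuleCat.ofHom (externalMap f.hom.hom LinearMap.id)
      naturality N N' g := by ext1; exact external_hom_ext fun m n => rfl }
  map_id M := by ext N : 2; ext1; exact external_hom_ext fun m n => rfl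
  map_comp f g := by ext N : 2; ext1; exact external_hom_ext fun m n => rfl

lemma isNoetherianRing_of_finite (R : Type*) [Ring R] [Algebra k R] [Module.Finite k R] :
    IsNoetherianRing R :=
  isNoetherian_of_tower k (inferInstanceAs (IsNoetherian k R))

variable [IsNoetherianRing A] [IsNoetherianRing B] [IsNoetherianRing (A ⊗[k] B)]

lemma isLinearFunctor_of_exact {X Y : Type*} [Category* X] [Abelian X] [Linear k X]
    [Category* Y] [Abelian Y] [Linear k Y] (F : X ⥤ Y) [F.Additive] [F.Linear k]
    (h : ∀ S : ShortComplex X, S.ShortExact → (S.map F).Exact ∧ Epi (F.map S.g)) :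
    IsLinearFunctor k F :=
  ⟨inferInstance, inferInstance, (F.preservesFiniteColimits_tfae.out 0 3).1 h⟩

lemma isBilinear_externalTensor : IsBilinearFunctor k (externalTensor k A B) where
  right M := by
    have : ((externalTensor k A B).obj M).Additive := ⟨fun {N N' f g} => by
      ext1; exact external_hom_ext fun m n => TensorProduct.tmul_add _ _ _⟩
    have : ((externalTensor k A B).obj M).Linear k := ⟨fun f c => by
      ext1; refine external_hom_ext fun m n => ?_
      change m ⊗ₜ[k] (algebraMap k B c • f.hom.hom n) =
        algebraMap k (A ⊗[k] B) c • (m ⊗ₜ[k] f.hom.hom n)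
      rw [algebraMap_smul, algebraMap_smul, TensorProduct.tmul_smul]⟩
    refine isLinearFunctor_of_exact k _ fun S hS => ⟨?_, ?_⟩
    · rw [fgModuleCat_exact_iff]
      have := hS.epi_g
      exact lTensor_exact M (f := S.f.hom.hom.restrictScalars k)
        (g := S.g.hom.hom.restrictScalars k)
        ((fgModuleCat_exact_iff S).1 hS.exact) ((fgModuleCat_epi_iff B S.g).1 hS.epi_g)
    · rw [fgModuleCat_epi_iff]
      exact LinearMap.lTensor_surjective M (g := S.g.hom.hom.restrictScalars k)
        ((fgModuleCat_epi_iff B S.g).1 hS.epi_g)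
  left N := by
    have : ((externalTensor k A B).flip.obj N).Additive := ⟨fun {N N' f g} => by
      ext1; exact external_hom_ext fun m n => TensorProduct.add_tmul _ _ _⟩
    have : ((externalTensor k A B).flip.obj N).Linear k := ⟨fun f c => by
      ext1; refine external_hom_ext fun m n => ?_
      change (algebraMap k A c • f.hom.hom m) ⊗ₜ[k] n =
        algebraMap k (A ⊗[k] B) c • (f.hom.hom m ⊗ₜ[k] n)
      rw [algebraMap_smul, algebraMap_smul, TensorProduct.smul_tmul']⟩
    refine isLinearFunctor_of_exact k _ fun S hS => ⟨?_, ?_⟩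
    · rw [fgModuleCat_exact_iff]
      exact rTensor_exact N (f := S.f.hom.hom.restrictScalars k)
        (g := S.g.hom.hom.restrictScalars k)
        ((fgModuleCat_exact_iff S).1 hS.exact) ((fgModuleCat_epi_iff A S.g).1 hS.epi_g)
    · rw [fgModuleCat_epi_iff]
      exact LinearMap.rTensor_surjective N (g := S.g.hom.hom.restrictScalars k)
        ((fgModuleCat_epi_iff A S.g).1 hS.epi_g)

end ExternalTensor

attribute [local instance] externalModule

/-! ### Finitely generated Hom modules -/

section HomFG

variable {k : Type v} [Field k] {T : Type*} [Category.{v} T] [Abelian T] [Linear k T] {x : T}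
  {R : Type v} [Ring R] [Algebra k R] (φ : R →ₐ[k] (End x)ᵐᵒᵖ)
  [hfin : ∀ t : T, Module.Finite k (x ⟶ t)]

open scoped ModuleCat in
lemma homModule_isFG (t : T) : ModuleCat.isFG R ((homModule φ).obj t) := by
  let e : (x ⟶ t) →ₗ[k] (homModule φ).obj t :=
    { (homModuleElt φ).symm.toAddMonoidHom with
      map_smul' := fun c f => by
        apply (homModuleElt φ).injective
        change c • f = (φ (algebraMap k R c)).unop ≫ f
        rw [AlgHom.commutes]
        change _ = (c • 𝟙 x) ≫ f
        simp }
  have : Module.Finite k ((homModule φ).obj t) :=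
    Module.Finite.of_surjective e (homModuleElt φ).symm.surjective
  exact Module.Finite.of_restrictScalars_finite k R _

/-- The functor `Hom(x, -)` with values in finitely generated modules. -/
noncomputable def homFG : T ⥤ FGModuleCat.{v} R :=
  (ModuleCat.isFG R).lift (homModule φ) (homModule_isFG φ)

/-- The morphism `x ⟶ t` underlying an element of the finitely generated module `Hom(x, t)`. -/
noncomputable def homFGElt {t : T} : (homFG φ).obj t ≃+ (x ⟶ t) := homModuleElt φ

open scoped ModuleCat in
lemma homFGElt_smul_field {t : T} (c : k) (f : (homFG φ).obj t) :
    homFGElt φ (c • f) = c • homFGElt φ f := by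
  change (φ (algebraMap k R c)).unop ≫ homFGElt φ f = _
  rw [AlgHom.commutes]
  change (c • 𝟙 x) ≫ homFGElt φ f = _
  simp

instance : (homFG φ).Additive where
  map_add {_ _ f g} := ObjectProperty.hom_ext _ ((homModule φ).map_add (f := f) (g := g))

instance : (homFG φ).Linear k where
  map_smul f c := ObjectProperty.hom_ext _ ((homModule φ).map_smul c f)

variable [IsNoetherianRing R]

lemma isLinearFunctor_homFG [Projective x] : IsLinearFunctor k (homFG φ) := by
  refine isLinearFunctor_of_exact k _ fun S hS => ?_
  have hH : PreservesFiniteColimits (homModule φ) := inferInstance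
  have h : ((S.map (homModule φ)).Exact ∧ Epi ((homModule φ).map S.g)) :=
    ((homModule φ).preservesFiniteColimits_tfae.out 3 0 :).1 hH S hS
  refine ⟨?_, ?_⟩
  · rw [← (S.map (homFG φ)).exact_map_iff_of_faithful
      (forget₂ (FGModuleCat.{v} R) (ModuleCat.{v} R))]
    exact h.1
  · rw [fgModuleCat_epi_iff, ← ModuleCat.epi_iff_surjective]
    exact h.2

/-- Every finitely generated module over the endomorphism algebra of a projective object `x` is of
the form `Hom(x, t)`. -/
lemma exists_homFG_iso [Projective x] (hφ : Function.Bijective φ) (M : FGModuleCat.{v} R) :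
    ∃ t, Nonempty ((homFG φ).obj t ≅ M) := by
  have := isIso_tensorGenUnit φ hφ
  let e : M.obj ≅ (homModule φ).obj ((tensorGen φ).obj M) := (asIso (tensorGenUnit φ)).app M
  exact ⟨(tensorGen φ).obj M, ⟨ObjectProperty.isoMk _ e.symm⟩⟩

end HomFG

/-! ### Deligne products as module categories -/

section DeligneModel

open scoped TensorProduct ModuleCat

/-- The action of a linear functor on endomorphism algebras. -/
def mapEndAlgHom {k X Y : Type*} [Field k] [Category* X] [Abelian X] [Linear k X]
    [Category* Y] [Abelian Y] [Linear k Y] (F : X ⥤ Y) [F.Additive] [F.Linear k] (x : X) :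
    End x →ₐ[k] End (F.obj x) :=
  AlgHom.ofLinearMap (F.mapLinearMap k) (F.map_id x) fun f g => F.map_comp g f

/-- The external product `c ⊠ d ⟶ c' ⊠ d'` of morphisms `c ⟶ c'` and `d ⟶ d'`. -/
def boxHom {C D T : Type*} [Category* C] [Category* D] [Category* T] (box : C ⥤ D ⥤ T)
    {c c' : C} {d d' : D} (f : c ⟶ c') (g : d ⟶ d') :
    (box.obj c).obj d ⟶ (box.obj c').obj d' :=
  (box.map f).app d ≫ (box.obj c').map g

lemma boxHom_comp {C D T : Type*} [Category* C] [Category* D] [Category* T]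
    (box : C ⥤ D ⥤ T) {c c' c'' : C} {d d' d'' : D} (f : c ⟶ c') (g : d ⟶ d')
    (f' : c' ⟶ c'') (g' : d' ⟶ d'') :
    boxHom box (f ≫ f') (g ≫ g') = boxHom box f g ≫ boxHom box f' g' := by
  simp [boxHom]

variable {k : Type v} [Field k]
  {C : Type u₁} [Category.{v} C] [Abelian C] [Linear k C]
  {D : Type u₂} [Category.{v} D] [Abelian D] [Linear k D]
  {T : Type u₃} [Category.{v} T] [Abelian T] [Linear k T]
  {box : C ⥤ D ⥤ T} (hbox : IsBilinearFunctor k box) (p : C) (q : D)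

include hbox in
lemma boxHom_add_left {c c' : C} {d d' : D} (f f' : c ⟶ c') (g : d ⟶ d') :
    boxHom box (f + f') g = boxHom box f g + boxHom box f' g := by
  have := (hbox.left d).additive
  have h : (box.map (f + f')).app d = (box.map f).app d + (box.map f').app d :=
    (box.flip.obj d).map_add (f := f) (g := f')
  rw [boxHom, h, Preadditive.add_comp]; rfl

include hbox in
lemma boxHom_add_right {c c' : C} {d d' : D} (f : c ⟶ c') (g g' : d ⟶ d') :
    boxHom box f (g + g') = boxHom box f g + boxHom box f g' := by
  have := (hbox.right c').additive
  rw [boxHom, Functor.map_add, Preadditive.comp_add]; rfl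

include hbox in
lemma boxHom_smul_left {c c' : C} {d d' : D} (r : k) (f : c ⟶ c') (g : d ⟶ d') :
    boxHom box (r • f) g = r • boxHom box f g := by
  have := (hbox.left d).additive
  have := (hbox.left d).linear
  have h : (box.map (r • f)).app d = r • (box.map f).app d :=
    (box.flip.obj d).map_smul r f
  rw [boxHom, h, Linear.smul_comp]; rfl

include hbox in
lemma boxHom_smul_right {c c' : C} {d d' : D} (r : k) (f : c ⟶ c') (g : d ⟶ d') :
    boxHom box f (r • g) = r • boxHom box f g := by
  have := (hbox.right c').additive
  have := (hbox.right c').linear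
  rw [boxHom, Functor.map_smul, Linear.comp_smul]; rfl

/-- The action of `End p ⊗ End q` on `p ⊠ q`. -/
noncomputable def boxEnd : (End p)ᵐᵒᵖ ⊗[k] (End q)ᵐᵒᵖ →ₐ[k] (End ((box.obj p).obj q))ᵐᵒᵖ :=
  have := (hbox.left q).additive
  have := (hbox.left q).linear
  have := (hbox.right p).additive
  have := (hbox.right p).linear
  Algebra.TensorProduct.lift (AlgHom.op (mapEndAlgHom (k := k) (box.flip.obj q) p))
    (AlgHom.op (mapEndAlgHom (k := k) (box.obj p) q)) fun a b => by
      apply MulOpposite.unop_injective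
      exact ((box.map a.unop).naturality b.unop).symm

lemma boxEnd_tmul (a : (End p)ᵐᵒᵖ) (b : (End q)ᵐᵒᵖ) :
    (boxEnd hbox p q (a ⊗ₜ b)).unop = boxHom box (show p ⟶ p from a.unop) b.unop := by
  have := (hbox.left q).additive
  have := (hbox.left q).linear
  have := (hbox.right p).additive
  have := (hbox.right p).linear
  have h : boxEnd hbox p q (a ⊗ₜ b) =
      (show (End ((box.obj p).obj q))ᵐᵒᵖ from
        AlgHom.op (mapEndAlgHom (k := k) (box.flip.obj q) p) a) *
      AlgHom.op (mapEndAlgHom (k := k) (box.obj p) q) b := by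
    unfold boxEnd
    exact Algebra.TensorProduct.lift_tmul ..
  rw [h]
  rfl

variable [∀ c : C, Module.Finite k (p ⟶ c)] [∀ d : D, Module.Finite k (q ⟶ d)]

instance : Module.Finite k (End p)ᵐᵒᵖ :=
  Module.Finite.equiv (show (p ⟶ p) ≃ₗ[k] _ from MulOpposite.opLinearEquiv k)

variable (k) in
/-- The model for the Deligne product: `(c, d) ↦ Hom(p, c) ⊗ Hom(q, d)`. -/
noncomputable def boxModel :
    C ⥤ D ⥤ FGModuleCat.{v} ((End p)ᵐᵒᵖ ⊗[k] (End q)ᵐᵒᵖ) :=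
  homFG (AlgHom.id k (End p)ᵐᵒᵖ) ⋙ externalTensor k (End p)ᵐᵒᵖ (End q)ᵐᵒᵖ ⋙
    (Functor.whiskeringLeft _ _ _).obj (homFG (AlgHom.id k (End q)ᵐᵒᵖ))

/-- The pure tensor of `f : p ⟶ c` and `g : q ⟶ d` in `Hom(p, c) ⊗ Hom(q, d)`. -/
noncomputable def pureTensor {c : C} {d : D} (f : p ⟶ c) (g : q ⟶ d) :
    ((boxModel k p q).obj c).obj d :=
  ((homFGElt (AlgHom.id k (End p)ᵐᵒᵖ)).symm f) ⊗ₜ[k]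
    ((homFGElt (AlgHom.id k (End q)ᵐᵒᵖ)).symm g)

instance : IsNoetherianRing ((End p)ᵐᵒᵖ ⊗[k] (End q)ᵐᵒᵖ) := isNoetherianRing_of_finite k _

lemma isBilinear_boxModel [Projective p] [Projective q] :
    IsBilinearFunctor k (boxModel k p q) := by
  have : IsNoetherianRing (End p)ᵐᵒᵖ := isNoetherianRing_of_finite k _
  have : IsNoetherianRing (End q)ᵐᵒᵖ := isNoetherianRing_of_finite k _
  have h := isBilinear_externalTensor k (End p)ᵐᵒᵖ (End q)ᵐᵒᵖ
  exact
    { right := fun c => (isLinearFunctor_homFG (AlgHom.id k (End q)ᵐᵒᵖ)).comp k (h.right _)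
      left := fun d => (isLinearFunctor_homFG (AlgHom.id k (End p)ᵐᵒᵖ)).comp k (h.left _) }

lemma pureTensor_smul {c : C} {d : D} (a : (End p)ᵐᵒᵖ) (b : (End q)ᵐᵒᵖ) (f : p ⟶ c) (g : q ⟶ d) :
    (a ⊗ₜ[k] b) • pureTensor (k := k) p q f g =
      pureTensor (k := k) p q (a.unop ≫ f) (b.unop ≫ g) := rfl

lemma boxModel_map {c c' : C} {d d' : D} (u : c ⟶ c') (w : d ⟶ d') (f : p ⟶ c) (g : q ⟶ d) :
    (boxHom (boxModel k p q) u w).hom.hom (pureTensor (k := k) p q f g) =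
      pureTensor (k := k) p q (f ≫ u) (g ≫ w) := rfl

lemma boxModel_hom_ext {c : C} {d : D} {X : Type v} [AddCommGroup X]
    [Module ((End p)ᵐᵒᵖ ⊗[k] (End q)ᵐᵒᵖ) X]
    {α β : ((boxModel k p q).obj c).obj d →ₗ[(End p)ᵐᵒᵖ ⊗[k] (End q)ᵐᵒᵖ] X}
    (h : ∀ f g, α (pureTensor p q f g) = β (pureTensor p q f g)) : α = β :=
  external_hom_ext fun f g => h f g

/-- The `p ⊠ q`-component of the model is free on `𝟙 ⊗ 𝟙`. -/
lemma bijective_smul_pureTensor_id :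
    Function.Bijective fun r : (End p)ᵐᵒᵖ ⊗[k] (End q)ᵐᵒᵖ =>
      r • pureTensor (k := k) p q (𝟙 p) (𝟙 q) := by
  refine bijective_toSpanSingleton_tmul ?_ ?_
  · have : Function.Bijective fun a : (End p)ᵐᵒᵖ => a.unop ≫ 𝟙 p := by
      simpa using! MulOpposite.unop_bijective
    exact this
  · have : Function.Bijective fun a : (End q)ᵐᵒᵖ => a.unop ≫ 𝟙 q := by
      simpa using! MulOpposite.unop_bijective
    exact this

/-- The additive map underlying `boxComparison`. -/
noncomputable def boxComparisonAux (c : C) (d : D) :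
    (homFG (AlgHom.id k (End p)ᵐᵒᵖ)).obj c ⊗[k] (homFG (AlgHom.id k (End q)ᵐᵒᵖ)).obj d →+
      ((box.obj p).obj q ⟶ (box.obj c).obj d) :=
  TensorProduct.liftAddHom
    (AddMonoidHom.mk' (fun f => AddMonoidHom.mk' (fun g =>
        boxHom box (homFGElt (AlgHom.id k (End p)ᵐᵒᵖ) f) (homFGElt (AlgHom.id k (End q)ᵐᵒᵖ) g))
      fun g g' => by rw [map_add, boxHom_add_right hbox])
      fun f f' => by
        ext1 g
        change boxHom box (homFGElt _ (f + f')) (homFGElt _ g) =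
          boxHom box (homFGElt _ f) (homFGElt _ g) + boxHom box (homFGElt _ f') (homFGElt _ g)
        rw [map_add, boxHom_add_left hbox])
    fun r f g => by
      change boxHom box (homFGElt _ (r • f)) (homFGElt _ g) =
        boxHom box (homFGElt _ f) (homFGElt _ (r • g))
      rw [homFGElt_smul_field, homFGElt_smul_field, boxHom_smul_left hbox, boxHom_smul_right hbox]

lemma boxComparisonAux_smul {c : C} {d : D} (a : (End p)ᵐᵒᵖ) (b : (End q)ᵐᵒᵖ)
    (y : (homFG (AlgHom.id k (End p)ᵐᵒᵖ)).obj c ⊗[k] (homFG (AlgHom.id k (End q)ᵐᵒᵖ)).obj d) :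
    boxComparisonAux hbox p q c d ((a ⊗ₜ[k] b) • y) =
      (boxEnd hbox p q (a ⊗ₜ[k] b)).unop ≫ boxComparisonAux hbox p q c d y := by
  induction y with
  | zero => simp
  | tmul f g =>
    rw [boxEnd_tmul]
    exact boxHom_comp box (C := C) (D := D) (show p ⟶ p from a.unop) b.unop _ _
  | add y z hy hz => rw [smul_add, map_add, map_add, Preadditive.comp_add, hy, hz]

/-- The natural map `Hom(p, c) ⊗ Hom(q, d) ⟶ Hom(p ⊠ q, c ⊠ d)`. -/
noncomputable def boxComparison (c : C) (d : D) :
    ((boxModel k p q).obj c).obj d →ₗ[(End p)ᵐᵒᵖ ⊗[k] (End q)ᵐᵒᵖ]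
      (homModule (boxEnd hbox p q)).obj ((box.obj c).obj d) :=
  let β : ((boxModel k p q).obj c).obj d →+
      (homModule (boxEnd hbox p q)).obj ((box.obj c).obj d) :=
    (homModuleElt (boxEnd hbox p q)).symm.toAddMonoidHom.comp (boxComparisonAux hbox p q c d)
  { β with
    map_smul' := map_smul_of_tmul β fun a b y =>
      congr_arg (homModuleElt (boxEnd hbox p q)).symm (boxComparisonAux_smul hbox p q a b y) }

lemma boxComparison_pureTensor {c : C} {d : D} (f : p ⟶ c) (g : q ⟶ d) :
    homModuleElt (boxEnd hbox p q) (boxComparison hbox p q c d (pureTensor p q f g)) =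
      boxHom box f g := rfl

/-- The comparison `(p ⊠ q) ⊗ (Hom(p, c) ⊗ Hom(q, d)) ⟶ c ⊠ d`. -/
noncomputable def boxCounit :
    (compBox (boxModel k p q) T).obj (tensorGen (boxEnd hbox p q)) ⟶ box where
  app c :=
    { app d := (tensorGenEquiv (boxEnd hbox p q)).symm
        (homOfLinear (boxComparison hbox p q c d))
      naturality d d' g := by
        apply (tensorGenEquiv (boxEnd hbox p q)).injective
        refine (tensorGenEquiv_map_comp (boxEnd hbox p q)
          (((boxModel k p q).obj c).map g) _).trans ?_
        refine Eq.trans ?_ (tensorGenEquiv_comp (boxEnd hbox p q) _ ((box.obj c).map g)).symm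
        rw [Equiv.apply_symm_apply, Equiv.apply_symm_apply]
        ext1
        refine boxModel_hom_ext p q fun a b => ?_
        apply (homModuleElt (boxEnd hbox p q)).injective
        change boxHom box a (b ≫ g) = boxHom box a b ≫ (box.obj c).map g
        simp [boxHom] }
  naturality c c' f := by
    ext d
    apply (tensorGenEquiv (boxEnd hbox p q)).injective
    refine (tensorGenEquiv_map_comp (boxEnd hbox p q) (((boxModel k p q).map f).app d) _).trans ?_
    refine Eq.trans ?_ (tensorGenEquiv_comp (boxEnd hbox p q) _ ((box.map f).app d)).symm
    rw [Equiv.apply_symm_apply, Equiv.apply_symm_apply]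
    ext1
    refine boxModel_hom_ext p q fun a b => ?_
    apply (homModuleElt (boxEnd hbox p q)).injective
    change boxHom box (a ≫ f) b = boxHom box a b ≫ (box.map f).app d
    simp [boxHom]

lemma boxCounit_app (c : C) (d : D) : ((boxCounit hbox p q).app c).app d =
    (tensorGenEquiv (boxEnd hbox p q)).symm (homOfLinear (boxComparison hbox p q c d)) := rfl

variable {p q} in
/-- The comparison is invertible, as both sides are bilinear and it is invertible at `(p, q)`, where
both sides are `p ⊠ q`. -/
lemma isIso_boxCounit [Projective p] [Projective q] (hp : Generates p) (hq : Generates q) :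
    IsIso (boxCounit hbox p q) := by
  have hb : IsBilinearFunctor k ((compBox (boxModel k p q) T).obj (tensorGen (boxEnd hbox p q))) :=
    (isBilinear_boxModel p q).compBox (isLinearFunctor_tensorGen _)
  let e₀ : FGModuleCat.of ((End p)ᵐᵒᵖ ⊗[k] (End q)ᵐᵒᵖ) ((End p)ᵐᵒᵖ ⊗[k] (End q)ᵐᵒᵖ) ⟶
      ((boxModel k p q).obj p).obj q :=
    FGModuleCat.ofHom (LinearMap.toSpanSingleton _ _ (pureTensor (k := k) p q (𝟙 p) (𝟙 q)))
  have he₀ : IsIso e₀ := by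
    have := (fgModuleCat_epi_iff _ e₀).2 (bijective_smul_pureTensor_id p q).surjective
    have := (fgModuleCat_mono_iff _ e₀).2 (bijective_smul_pureTensor_id p q).injective
    exact isIso_of_mono_of_epi e₀
  have h : (tensorGen (boxEnd hbox p q)).map e₀ ≫ ((boxCounit hbox p q).app p).app q =
      (tensorGenRegularIso (boxEnd hbox p q)).hom := by
    apply (tensorGenEquiv (boxEnd hbox p q)).injective
    refine (tensorGenEquiv_map_comp (boxEnd hbox p q) e₀ _).trans ?_
    refine Eq.trans ?_ (Equiv.apply_symm_apply _ _).symm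
    rw [boxCounit_app, Equiv.apply_symm_apply]
    ext
    apply (homModuleElt (boxEnd hbox p q)).injective
    change homModuleElt (boxEnd hbox p q) (boxComparison hbox p q p q
      ((1 : (End p)ᵐᵒᵖ ⊗[k] (End q)ᵐᵒᵖ) • pureTensor p q (𝟙 p) (𝟙 q))) =
        homModuleElt (boxEnd hbox p q) ((1 : (End p)ᵐᵒᵖ ⊗[k] (End q)ᵐᵒᵖ) •
          (homModuleElt (boxEnd hbox p q)).symm (𝟙 ((box.obj p).obj q)))
    rw [one_smul, one_smul, boxComparison_pureTensor, AddEquiv.apply_symm_apply]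
    simp [boxHom]
  have : IsIso ((tensorGen (boxEnd hbox p q)).map e₀ ≫ ((boxCounit hbox p q).app p).app q) := by
    rw [h]; infer_instance
  have : IsIso (((boxCounit hbox p q).app p).app q) := IsIso.of_isIso_comp_left
    ((tensorGen (boxEnd hbox p q)).map e₀) _
  exact hp.isIso_natTrans₂ hq (fun a => (hb.right a).rightExact) (fun b => (hb.left b).rightExact)
    (fun a => (hbox.right a).rightExact) (fun b => (hbox.left b).rightExact) (boxCounit hbox p q)

end DeligneModel

section EvaluationUnit

variable {k : Type*} [Field k] {T : Type*} [Category.{v} T] [Abelian T] [Linear k T] {x : T}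
  {R : Type v} [Ring R] [Algebra k R] (φ : R →ₐ[k] (End x)ᵐᵒᵖ)
  {F : T ⥤ FGModuleCat.{v} R} [F.Additive] {e : F.obj x}
  (he : ∀ r, (F.map (φ r).unop).hom.hom e = r • e)

/-- Evaluation `Hom(x, t) ⟶ F t` at an element of `F x`. -/
noncomputable def evalAt (t : T) : (homModule φ).obj t →ₗ[R] F.obj t where
  toFun h := (F.map (homModuleElt φ h)).hom.hom e
  map_add' h h' := by
    rw [map_add, F.map_add]; rfl
  map_smul' r h := by
    rw [homModuleElt_smul, F.map_comp]
    change (F.map (homModuleElt φ h)).hom.hom ((F.map _).hom.hom e) = _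
    rw [he, map_smul]
    rfl

lemma evalAt_naturality {t t' : T} (g : t ⟶ t') :
    (homModule φ).map g ≫ homOfLinear (evalAt φ he t') =
      homOfLinear (evalAt φ he t) ≫ (F.map g).hom := by
  apply ModuleCat.hom_ext
  ext h
  change (F.map (homModuleElt _ h ≫ g)).hom.hom _ = _
  rw [F.map_comp]
  rfl

variable [IsNoetherianRing R]

/-- The comparison `M ⟶ F (x ⊗ M)` given by an element of `F x`. -/
noncomputable def evalUnit : 𝟭 (FGModuleCat.{v} R) ⟶ tensorGen φ ⋙ F where
  app M := ObjectProperty.homMk ((tensorGenUnit φ).app M ≫ homOfLinear (evalAt φ he _))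
  naturality M M' f := by
    apply ObjectProperty.hom_ext
    change f.hom ≫ (tensorGenUnit _).app M' ≫ _ = ((tensorGenUnit _).app M ≫ _) ≫ (F.map _).hom
    have h := (tensorGenUnit φ).naturality f
    rw [Category.assoc, ← evalAt_naturality]
    exact (Category.assoc _ _ _).symm.trans ((congr_arg (· ≫ _) h).trans (Category.assoc _ _ _))

/-- If `F x` is free on `e`, the comparison is invertible, as it is so on the regular module. -/
lemma isIso_evalUnit [PreservesFiniteColimits F] (hb : Function.Bijective fun r : R => r • e) :
    IsIso (evalUnit φ he) := by
  have : PreservesFiniteColimits (tensorGen φ ⋙ F) := comp_preservesFiniteColimits _ _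
  have h : (evalUnit φ he).app (FGModuleCat.of R R) ≫ F.map (tensorGenRegularIso φ).hom =
      FGModuleCat.ofHom (LinearMap.toSpanSingleton R (F.obj x) e) := by
    apply ObjectProperty.hom_ext
    change ((tensorGenUnit φ).app (FGModuleCat.of R R) ≫ homOfLinear _) ≫ (F.map _).hom = _
    rw [Category.assoc, ← evalAt_naturality, ← Category.assoc, tensorGenUnit_regular]
    ext
    change (F.map (homModuleElt φ ((1 : R) • (homModuleElt φ).symm (𝟙 _)))).hom.hom e = (1 : R) • e
    rw [one_smul, one_smul, AddEquiv.apply_symm_apply, F.map_id]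
    rfl
  have h₁ : Epi ((evalUnit φ he).app (FGModuleCat.of R R) ≫ F.map (tensorGenRegularIso φ).hom) := by
    rw [h]; exact (fgModuleCat_epi_iff R _).2 hb.surjective
  have h₂ :
      Mono ((evalUnit φ he).app (FGModuleCat.of R R) ≫ F.map (tensorGenRegularIso φ).hom) := by
    rw [h]; exact (fgModuleCat_mono_iff R _).2 hb.injective
  have := isIso_of_mono_of_epi
    ((evalUnit φ he).app (FGModuleCat.of R R) ≫ F.map (tensorGenRegularIso φ).hom)
  have : IsIso ((evalUnit φ he).app (FGModuleCat.of R R)) := IsIso.of_isIso_comp_right _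
    (F.map (tensorGenRegularIso φ).hom)
  exact (fgModuleCat_generates_regular R).isIso_natTrans _

end EvaluationUnit

/-! ### Generators, equivalences and the Deligne product -/

section Transport

lemma Generates.of_iso {T : Type*} [Category* T] [Abelian T] {x y : T} (hx : Generates x)
    (e : x ≅ y) : Generates y := fun Y => by
  obtain ⟨n, f, _⟩ := hx Y
  exact ⟨n, (biproduct.mapIso fun _ => e).inv ≫ f, inferInstance⟩

lemma Generates.of_isEquivalence {T K : Type*} [Category* T] [Abelian T] [Category* K] [Abelian K]
    (F : T ⥤ K) [F.IsEquivalence] {x : T} (hx : Generates (F.obj x)) : Generates x := fun Y => by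
  obtain ⟨n, f, _⟩ := hx (F.obj Y)
  have : F.Additive := Functor.additive_of_preserves_binary_products F
  have : PreservesFiniteBiproducts F := Functor.preservesFiniteBiproductsOfAdditive F
  let g : F.obj (⨁ fun _ : Fin n => x) ⟶ F.obj Y := (F.mapBiproduct fun _ : Fin n => x).hom ≫ f
  have : Epi (F.map (F.preimage g)) := by
    rw [F.map_preimage]
    exact epi_comp' inferInstance ‹_›
  exact ⟨n, F.preimage g, F.epi_of_epi_map this⟩

open scoped ModuleCat in
lemma finite_fgModuleCat_hom {k R : Type v} [Field k] [Ring R] [Algebra k R] [Module.Finite k R]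
    (M N : FGModuleCat.{v} R) : Module.Finite k (M ⟶ N) := by
  have : Module.Finite k M := Module.Finite.trans R M
  have : Module.Finite k N := Module.Finite.trans R N
  let φ : (M ⟶ N) →ₗ[k] (M →ₗ[k] N) :=
    { toFun := fun f => f.hom.hom.restrictScalars k
      map_add' := fun _ _ => rfl
      map_smul' := fun c f => by
        ext m
        exact algebraMap_smul R c (f.hom.hom m) }
  refine Module.Finite.of_injective φ fun f g h => ?_
  ext m
  exact LinearMap.congr_fun h m

end Transport

section DeligneEquivalence

open scoped TensorProduct ModuleCat

variable {k : Type v} [Field k]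
  {C : Type u₁} [Category.{v} C] [Abelian C] [Linear k C]
  {D : Type u₂} [Category.{v} D] [Abelian D] [Linear k D]

section Unit

variable {T : Type u₃} [Category.{v} T] {box : C ⥤ D ⥤ T} {p : C} {q : D}
  [∀ c : C, Module.Finite k (p ⟶ c)] [∀ d : D, Module.Finite k (q ⟶ d)]
  {F : T ⥤ FGModuleCat.{v} ((End p)ᵐᵒᵖ ⊗[k] (End q)ᵐᵒᵖ)}
  (ψ : (compBox box (FGModuleCat.{v} ((End p)ᵐᵒᵖ ⊗[k] (End q)ᵐᵒᵖ))).obj F ≅ boxModel k p q)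

/-- A component of the identification of `F` with the model. -/
noncomputable def modelApp (c : C) (d : D) :
    ((boxModel k p q).obj c).obj d ⟶ F.obj ((box.obj c).obj d) :=
  (ψ.inv.app c).app d

instance (c : C) (d : D) : IsIso (modelApp ψ c d) :=
  inferInstanceAs (IsIso ((ψ.inv.app c).app d))

lemma modelApp_boxHom {c c' : C} {d d' : D} (f : c ⟶ c') (g : d ⟶ d') :
    modelApp ψ c d ≫ F.map (boxHom box f g) =
      boxHom (boxModel k p q) f g ≫ modelApp ψ c' d' := by
  have h₁ : modelApp ψ c d ≫ F.map ((box.map f).app d) =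
    ((boxModel k p q).map f).app d ≫ modelApp ψ c' d :=
      (congr_app (ψ.inv.naturality f) d).symm
  have h₂ : modelApp ψ c' d ≫ F.map ((box.obj c').map g) =
    ((boxModel k p q).obj c').map g ≫ modelApp ψ c' d' :=
      ((ψ.inv.app c').naturality g).symm
  rw [boxHom, F.map_comp, reassoc_of% h₁, h₂, boxHom, Category.assoc]

/-- The canonical generator of the module `F (p ⊠ q)`, when `F` is identified with the model on
external products. -/
noncomputable def modelGenerator : F.obj ((box.obj p).obj q) :=
  (modelApp ψ p q).hom.hom (pureTensor p q (𝟙 p) (𝟙 q))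

lemma map_boxHom_modelGenerator {c : C} {d : D} (f : p ⟶ c) (g : q ⟶ d) :
    (F.map (boxHom box f g)).hom.hom (modelGenerator ψ) =
      (modelApp ψ c d).hom.hom (pureTensor p q f g) := by
  have h' := congr_arg (fun u => u.hom.hom (pureTensor p q (𝟙 p) (𝟙 q))) (modelApp_boxHom ψ f g)
  refine h'.trans ?_
  change (modelApp ψ c d).hom.hom
    ((boxHom (boxModel k p q) f g).hom.hom (pureTensor p q (𝟙 p) (𝟙 q))) = _
  rw [boxModel_map, Category.id_comp, Category.id_comp]

lemma bijective_smul_modelGenerator :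
    Function.Bijective fun r : (End p)ᵐᵒᵖ ⊗[k] (End q)ᵐᵒᵖ => r • modelGenerator ψ := by
  let e := FGModuleCat.isoToLinearEquiv (asIso (modelApp ψ p q))
  convert e.bijective.comp (bijective_smul_pureTensor_id p q) using 1
  funext r
  exact (map_smul e r _).symm

/-- A functor identified with the model on external products sends `p ⊠ q` to a free module of rank
one. -/
lemma nonempty_regular_iso {F : T ⥤ FGModuleCat.{v} ((End p)ᵐᵒᵖ ⊗[k] (End q)ᵐᵒᵖ)}
    (ψ : (compBox box (FGModuleCat.{v} ((End p)ᵐᵒᵖ ⊗[k] (End q)ᵐᵒᵖ))).obj F ≅ boxModel k p q) :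
    Nonempty (FGModuleCat.of ((End p)ᵐᵒᵖ ⊗[k] (End q)ᵐᵒᵖ) ((End p)ᵐᵒᵖ ⊗[k] (End q)ᵐᵒᵖ) ≅
      F.obj ((box.obj p).obj q)) :=
  ⟨LinearEquiv.toFGModuleCatIso (LinearEquiv.ofBijective
    (LinearMap.toSpanSingleton _ _ (modelGenerator ψ)) (bijective_smul_modelGenerator ψ))⟩

variable [Abelian T] [Linear k T] (hbox : IsBilinearFunctor k box) (hF : IsLinearFunctor k F)

include hF in
lemma map_boxEnd_modelGenerator (r : (End p)ᵐᵒᵖ ⊗[k] (End q)ᵐᵒᵖ) :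
    (F.map (boxEnd hbox p q r).unop).hom.hom (modelGenerator ψ) = r • modelGenerator ψ := by
  have := hF.additive
  induction r with
  | zero =>
    rw [map_zero]
    change (F.map 0).hom.hom _ = _
    rw [F.map_zero]
    exact (zero_smul ((End p)ᵐᵒᵖ ⊗[k] (End q)ᵐᵒᵖ) (modelGenerator ψ)).symm
  | tmul a b =>
    rw [boxEnd_tmul, map_boxHom_modelGenerator, modelGenerator, ← map_smul, pureTensor_smul,
      Category.comp_id]
    exact congr_arg _ (congr_arg (pureTensor p q _) (Category.comp_id _).symm)
  | add r s hr hs =>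
    refine Eq.trans ?_ (add_smul r s (modelGenerator ψ)).symm
    rw [map_add, ← hr, ← hs]
    change (F.map ((boxEnd hbox p q r).unop + (boxEnd hbox p q s).unop)).hom.hom _ = _
    rw [F.map_add]; rfl

end Unit

variable {T : Type (v + 1)} [Category.{v} T] [Abelian T] [Linear k T]
  {box : C ⥤ D ⥤ T} {p : C} {q : D} [Projective p] [Projective q]
  [∀ c : C, Module.Finite k (p ⟶ c)] [∀ d : D, Module.Finite k (q ⟶ d)]

/-- The Deligne product of finite linear categories with projective generators `p` and `q` is the
category of finitely generated modules over `End p ⊗ End q`. The universal property is used for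
this module category, to construct the functor, and for the Deligne product itself, to identify the
composite with its inverse. -/
theorem IsDeligneProduct.exists_equivalence (hbox : IsDeligneProduct k box)
    (hp : Generates p) (hq : Generates q) :
    ∃ F : T ⥤ FGModuleCat.{v} ((End p)ᵐᵒᵖ ⊗[k] (End q)ᵐᵒᵖ), F.IsEquivalence ∧
      IsLinearFunctor k F ∧
      Nonempty ((compBox box (FGModuleCat.{v} ((End p)ᵐᵒᵖ ⊗[k] (End q)ᵐᵒᵖ))).obj F ≅
        boxModel k p q) := by
  have hK := hbox.isEquivalence (FGModuleCat.{v} ((End p)ᵐᵒᵖ ⊗[k] (End q)ᵐᵒᵖ))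
  have hT := hbox.isEquivalence T
  let model : (bilinearFunctors k C D
      (FGModuleCat.{v} ((End p)ᵐᵒᵖ ⊗[k] (End q)ᵐᵒᵖ))).FullSubcategory :=
    ⟨boxModel k p q, isBilinear_boxModel p q⟩
  let F' := (restrictAlongBox k hbox.bilinear
    (FGModuleCat.{v} ((End p)ᵐᵒᵖ ⊗[k] (End q)ᵐᵒᵖ))).objPreimage model
  let F := F'.obj
  have hF : IsLinearFunctor k F := F'.property
  let ψ : (compBox box (FGModuleCat.{v} ((End p)ᵐᵒᵖ ⊗[k] (End q)ᵐᵒᵖ))).obj F ≅ boxModel k p q :=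
    (bilinearFunctors k C D _).ι.mapIso ((restrictAlongBox k hbox.bilinear
      (FGModuleCat.{v} ((End p)ᵐᵒᵖ ⊗[k] (End q)ᵐᵒᵖ))).objObjPreimageIso model)
  let G := tensorGen (boxEnd hbox.bilinear p q)
  have hε := isIso_boxCounit hbox.bilinear hp hq
  have := hF.additive
  have := hF.rightExact
  have hη := isIso_evalUnit (boxEnd hbox.bilinear p q)
    (map_boxEnd_modelGenerator ψ hbox.bilinear hF) (bijective_smul_modelGenerator ψ)
  have hG : IsLinearFunctor k G := isLinearFunctor_tensorGen _
  let FG : (linearFunctors k T T).FullSubcategory := ⟨F ⋙ G, hF.comp k hG⟩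
  let one : (linearFunctors k T T).FullSubcategory :=
    ⟨𝟭 T, inferInstance, inferInstance, inferInstance⟩
  let e : (restrictAlongBox k hbox.bilinear T).obj FG ≅
      (restrictAlongBox k hbox.bilinear T).obj one :=
    ObjectProperty.isoMk _ (Functor.isoWhiskerRight ψ ((Functor.whiskeringRight D _ T).obj G) ≪≫
      @asIso _ _ _ _ (boxCounit hbox.bilinear p q) hε)
  let e' : F ⋙ G ≅ 𝟭 T :=
    (linearFunctors k T T).ι.mapIso ((restrictAlongBox k hbox.bilinear T).preimageIso e)
  exact ⟨F, (CategoryTheory.Equivalence.mk F G e'.symm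
    (@asIso _ _ _ _ _ hη).symm).isEquivalence_functor, hF, ⟨ψ⟩⟩

lemma IsDeligneProduct.projective_box (hbox : IsDeligneProduct k box)
    (hp : Generates p) (hq : Generates q) : Projective ((box.obj p).obj q) := by
  obtain ⟨F, _, hF, ⟨ψ⟩⟩ := hbox.exists_equivalence hp hq
  obtain ⟨e⟩ := nonempty_regular_iso ψ
  have hP : Projective (F.obj ((box.obj p).obj q)) :=
    Projective.of_iso e (fgModuleCat_projective_regular _)
  exact (F.asEquivalence.map_projective_iff _).1 hP

lemma IsDeligneProduct.generates_box (hbox : IsDeligneProduct k box)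
    (hp : Generates p) (hq : Generates q) : Generates ((box.obj p).obj q) := by
  obtain ⟨F, _, hF, ⟨ψ⟩⟩ := hbox.exists_equivalence hp hq
  obtain ⟨e⟩ := nonempty_regular_iso ψ
  exact ((fgModuleCat_generates_regular _).of_iso e).of_isEquivalence F

lemma IsDeligneProduct.finite_end_box (hbox : IsDeligneProduct k box)
    (hp : Generates p) (hq : Generates q) :
    Module.Finite k ((box.obj p).obj q ⟶ (box.obj p).obj q) := by
  obtain ⟨F, _, hF, ⟨ψ⟩⟩ := hbox.exists_equivalence hp hq
  have := hF.additive
  have := hF.linear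
  have := finite_fgModuleCat_hom (k := k) (F.obj ((box.obj p).obj q)) (F.obj ((box.obj p).obj q))
  exact Module.Finite.of_injective (F.mapLinearMap k) F.map_injective

/-- The Deligne product of finite linear categories is finite. -/
lemma IsDeligneProduct.isFiniteLinearCategory (hbox : IsDeligneProduct k box)
    (hp : Generates p) (hq : Generates q) : IsFiniteLinearCategory k T := by
  have := hbox.projective_box hp hq
  have := hbox.finite_end_box hp hq
  exact (hbox.generates_box hp hq).isFiniteLinearCategory

end DeligneEquivalence

/-! ### Simple modules over a tensor product of algebras -/

section SimpleModules

open scoped TensorProduct ModuleCat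

/-- An algebra is simple if it has a faithful finite-dimensional module without proper nonzero fully
invariant submodules: such a module is isotypic, and the algebra embeds into a power of it. -/
lemma isSimpleRing_of_isFullyInvariant (k S X : Type*) [Field k] [Ring S] [Algebra k S]
    [AddCommGroup X] [Module k X] [Module S X] [IsScalarTower k S X] [Module.Finite k X]
    [Nontrivial X] [FaithfulSMul S X]
    (h : ∀ N : Submodule S X, N.IsFullyInvariant → N = ⊥ ∨ N = ⊤) : IsSimpleRing S := by
  have : IsArtinian S X := isArtinian_of_tower k inferInstance
  obtain ⟨V, hV⟩ := IsAtomic.exists_atom (Submodule S X)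
  rw [← isSimpleModule_iff_isAtom] at hV
  have htop : isotypicComponent S X V = ⊤ :=
    (h _ (.isotypicComponent S X V)).resolve_left (bot_lt_isotypicComponent V).ne'
  have : IsSemisimpleModule S X := by
    rw [← Submodule.topEquiv (R := S) (M := X) |>.isSemisimpleModule_iff, ← htop]
    infer_instance
  have hX : IsIsotypicOfType S X V := .of_isotypicComponent_eq_top htop
  obtain ⟨n, g, hg⟩ := Module.Finite.exists_fin (R := k) (M := X)
  let ι : S →ₗ[S] (Fin n → X) := LinearMap.pi fun i => LinearMap.toSpanSingleton S X (g i)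
  have hι : Function.Injective ι := (injective_iff_map_eq_zero ι).2 fun s hs => by
    have : Algebra.lsmul k k X s = 0 := LinearMap.ext_on_range hg fun i => congr_fun hs i
    exact FaithfulSMul.eq_of_smul_eq_smul (α := X) fun x => by
      simpa using LinearMap.congr_fun this x
  have : IsSemisimpleModule S S := .of_injective ι hι
  refine (isSimpleRing_isArtinianRing_iff.2 ⟨this, IsIsotypicOfType.isIsotypic (S := V)
    fun I hI => ?_, ?_⟩).1
  · have := IsSimpleModule.nontrivial S I
    obtain ⟨s, hs⟩ := exists_ne (0 : I)
    obtain ⟨i, hi⟩ : ∃ i, ι s i ≠ 0 := by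
      by_contra! hc
      exact hs (Subtype.ext (hι (by rw [ZeroMemClass.coe_zero, map_zero]; exact funext hc)))
    let π : I →ₗ[S] X := (LinearMap.proj i).comp (ι.comp I.subtype)
    have hπ : Function.Injective π := π.injective_or_eq_zero.resolve_right fun h0 =>
      hi (LinearMap.congr_fun h0 s)
    let e := LinearEquiv.ofInjective π hπ
    have := IsSimpleModule.congr e.symm
    exact (hX (LinearMap.range π)).map e.trans
  · obtain ⟨x, hx⟩ := exists_ne (0 : X)
    exact ⟨0, 1, fun h01 => hx (by rw [← one_smul S x, ← h01, zero_smul])⟩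

/-- A separability element of `S` splits the action `S ⊗ X → X` on any module, naturally in `X`. -/
lemma IsSeparabilityElement.exists_section {k S : Type*} [Field k] [Ring S] [Algebra k S]
    {e : S ⊗[k] Sᵐᵒᵖ} (he : IsSeparabilityElement k S e) (X : Type*) [AddCommGroup X] [Module k X]
    [Module S X] [IsScalarTower k S X] :
    ∃ i : X →ₗ[k] S ⊗[k] X,
      (∀ s x, i (s • x) = (LinearMap.mulLeft k s).rTensor X (i x)) ∧
      (∀ (g : X →ₗ[S] X) (x : X), i (g x) = (g.restrictScalars k).lTensor S (i x)) ∧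
      ∀ x, TensorProduct.lift (Algebra.lsmul k k X).toLinearMap (i x) = x := by
  let act (x : X) : Sᵐᵒᵖ →ₗ[k] X := ((LinearMap.toSpanSingleton S X x).restrictScalars k).comp
    (MulOpposite.opLinearEquiv k).symm.toLinearMap
  have hact (x : X) (s : Sᵐᵒᵖ) : act x s = s.unop • x := rfl
  let i : X →ₗ[k] S ⊗[k] X :=
    { toFun := fun x => (act x).lTensor S e
      map_add' := fun x y => by
        have : act (x + y) = act x + act y := by ext; simp [hact]
        rw [this, LinearMap.lTensor_add, LinearMap.add_apply]
      map_smul' := fun c x => by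
        have : act (c • x) = c • act x := by ext s; exact smul_comm s.unop c x
        rw [this, LinearMap.lTensor_smul, LinearMap.smul_apply, RingHom.id_apply] }
  have hi (x : X) : i x = (act x).lTensor S e := rfl
  refine ⟨i, fun s x => ?_, fun g x => ?_, fun x => ?_⟩
  · have h₁ (r : S ⊗[k] Sᵐᵒᵖ) : (act (s • x)).lTensor S r =
        (act x).lTensor S ((1 ⊗ₜ MulOpposite.op s) * r) := by
      induction r with
      | zero => simp
      | tmul a b => simp [hact, mul_smul]
      | add r t hr ht => rw [map_add, hr, ht, mul_add, map_add]
    have h₂ (r : S ⊗[k] Sᵐᵒᵖ) : (LinearMap.mulLeft k s).rTensor X ((act x).lTensor S r) =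
        (act x).lTensor S ((s ⊗ₜ 1) * r) := by
      induction r with
      | zero => simp
      | tmul a b => simp
      | add r t hr ht => rw [map_add, map_add, hr, ht, mul_add, map_add]
    rw [hi, hi, h₁, h₂, he.comm]
  · have : act (g x) = (g.restrictScalars k).comp (act x) := by ext; simp [hact]
    rw [hi, hi, this, LinearMap.lTensor_comp_apply]
  · have h (r : S ⊗[k] Sᵐᵒᵖ) :
        TensorProduct.lift (Algebra.lsmul k k X).toLinearMap ((act x).lTensor S r) =
          AlgHom.mulLeftRight k S r 1 • x := by
      induction r with
      | zero => simp
      | tmul a b => simp [hact, mul_smul]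
      | add r t hr ht => rw [map_add, map_add, hr, ht, map_add, LinearMap.add_apply, add_smul]
    rw [hi, h, he.mul_eq_one, one_smul]

variable {k A B : Type v} [Field k] [Ring A] [Algebra k A] [Ring B] [Algebra k B]

/-- Over a perfect field, every finite-dimensional simple `A ⊗ B`-module is a retract of an external
tensor product of modules. -/
lemma exists_retract_external [PerfectField k] (X : Type v) [AddCommGroup X] [Module k X]
    [Module (A ⊗[k] B) X] [IsScalarTower k (A ⊗[k] B) X] [IsSimpleModule (A ⊗[k] B) X]
    [Module.Finite k X] :
    ∃ (M N : Type v) (_ : AddCommGroup M) (_ : Module k M) (_ : Module A M)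
      (_ : IsScalarTower k A M) (_ : AddCommGroup N) (_ : Module k N) (_ : Module B N)
      (_ : IsScalarTower k B N) (_ : Module.Finite A M) (_ : Module.Finite B N)
      (i : X →ₗ[A ⊗[k] B] M ⊗[k] N) (r : M ⊗[k] N →ₗ[A ⊗[k] B] X), ∀ x, r (i x) = x := by
  let ρ : A →ₐ[k] Module.End k X :=
    (Algebra.lsmul k k X).comp (Algebra.TensorProduct.includeLeft : A →ₐ[k] A ⊗[k] B)
  let τ : B →ₐ[k] Module.End k X :=
    (Algebra.lsmul k k X).comp (Algebra.TensorProduct.includeRight : B →ₐ[k] A ⊗[k] B)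
  have hρτ (a : A) (b : B) (x : X) : (a ⊗ₜ[k] b) • x = ρ a (τ b x) := by
    change _ = (a ⊗ₜ[k] (1 : B)) • ((1 : A) ⊗ₜ[k] b) • x
    rw [← mul_smul, Algebra.TensorProduct.tmul_mul_tmul, mul_one, one_mul]
  have hτρ (a : A) (b : B) (x : X) : τ b (ρ a x) = ρ a (τ b x) := by
    rw [← hρτ]
    change ((1 : A) ⊗ₜ[k] b) • (a ⊗ₜ[k] (1 : B)) • x = _
    rw [← mul_smul, Algebra.TensorProduct.tmul_mul_tmul, mul_one, one_mul]
  -- `X` is a retract of `S ⊗ X`, where `S` is the image of `A` in the endomorphisms of `X`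
  let S := ρ.range
  let τ' (b : B) : X →ₗ[S] X :=
    { τ b with
      map_smul' := by
        rintro ⟨_, a, rfl⟩ x
        exact hτρ a b x }
  have := IsSimpleModule.nontrivial (A ⊗[k] B) X
  have hS : IsSimpleRing S := by
    refine isSimpleRing_of_isFullyInvariant k S X fun N hN => ?_
    let N' : Submodule (A ⊗[k] B) X :=
      { N with
        smul_mem' := fun r x hx => by
          induction r with
          | zero => rw [zero_smul]; exact N.zero_mem
          | tmul a b => rw [hρτ]; exact N.smul_mem (⟨ρ a, a, rfl⟩ : S) (hN (τ' b) hx)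
          | add r s hr hs => rw [add_smul]; exact N.add_mem hr hs }
    exact (eq_bot_or_eq_top N').imp
      (fun h => Submodule.ext fun x => show x ∈ N' ↔ x ∈ (⊥ : Submodule (A ⊗[k] B) X) by rw [h])
      fun h => Submodule.ext fun x => show x ∈ N' ↔ x ∈ (⊤ : Submodule (A ⊗[k] B) X) by rw [h]
  obtain ⟨e, he⟩ := exists_isSeparabilityElement k S
  obtain ⟨i, hi₁, hi₂, hi₃⟩ := he.exists_section X
  let _ : Module A S := Module.compHom S ρ.rangeRestrict.toRingHom
  let _ : Module B X := Module.compHom X τ.toRingHom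
  have hA (a : A) (s : S) : a • s = ρ.rangeRestrict a * s := rfl
  have hB (b : B) (x : X) : b • x = τ b x := rfl
  have : IsScalarTower k A S := ⟨fun c a s => by simp [hA]⟩
  have : IsScalarTower k B X := ⟨fun c b x => by simp [hB]⟩
  have hfinA : Module.Finite A S := .of_restrictScalars_finite k A S
  have hfinB : Module.Finite B X := .of_restrictScalars_finite k B X
  refine ⟨S, X, inferInstance, inferInstance, inferInstance, inferInstance, inferInstance,
    inferInstance, inferInstance, inferInstance, hfinA, hfinB,
    { i with
      map_smul' := map_smul_of_tmul (X := X) (Y := S ⊗[k] X) i.toAddMonoidHom fun a b x => ?_ },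
    { TensorProduct.lift (Algebra.lsmul k k X).toLinearMap with
      map_smul' := map_smul_of_tmul (X := S ⊗[k] X) (Y := X)
        (TensorProduct.lift (Algebra.lsmul k k X).toLinearMap).toAddMonoidHom fun a b y => ?_ },
    hi₃⟩
  · rw [hρτ]
    change i (ρ.rangeRestrict a • τ' b x) = _
    rw [hi₁, hi₂]
    change _ = (a ⊗ₜ[k] b) • i x
    induction i x with
    | zero => simp
    | tmul s y => rfl
    | add y z hy hz => rw [map_add, map_add, hy, hz, smul_add]
  · change TensorProduct.lift (Algebra.lsmul k k X).toLinearMap ((a ⊗ₜ[k] b) • y) =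
      (a ⊗ₜ[k] b) • TensorProduct.lift (Algebra.lsmul k k X).toLinearMap y
    induction y with
    | zero => simp
    | tmul s x =>
      rw [external_smul_tmul, hρτ]
      change ρ a (s.1 (τ b x)) = ρ a (τ b (s.1 x))
      exact congr_arg _ ((τ' b).map_smul s x).symm
    | add y z hy hz => rw [smul_add, map_add, map_add, hy, hz, smul_add]

lemma isSimpleModule_of_simple {R : Type v} [Ring R] [IsNoetherianRing R] (X : FGModuleCat.{v} R)
    [Simple X] : IsSimpleModule R X := by
  have hne : Nontrivial X := by
    by_contra h
    rw [not_nontrivial_iff_subsingleton] at h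
    refine id_nonzero X ?_
    ext x
    exact Subsingleton.elim _ _
  refine (isSimpleModule_iff _ _).2
    { exists_pair_ne := ⟨⊥, ⊤, bot_ne_top⟩, eq_bot_or_eq_top := fun N => ?_ }
  let i : FGModuleCat.of R N ⟶ X := FGModuleCat.ofHom N.subtype
  have : Mono i := (fgModuleCat_mono_iff R i).2 N.subtype_injective
  by_cases hi : i = 0
  · refine Or.inl ((Submodule.eq_bot_iff N).2 fun x hx => ?_)
    exact congr_arg (fun u => u.hom.hom (⟨x, hx⟩ : N)) hi
  · have := isIso_of_mono_of_nonzero hi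
    refine Or.inr (eq_top_iff.2 fun x _ => ?_)
    obtain ⟨y, rfl⟩ := (fgModuleCat_epi_iff R i).1 inferInstance x
    exact y.2

lemma exists_retract_externalTensor [PerfectField k] [Module.Finite k A] [Module.Finite k B]
    (X : FGModuleCat.{v} (A ⊗[k] B)) [Simple X] :
    ∃ (M : FGModuleCat.{v} A) (N : FGModuleCat.{v} B),
      Nonempty (Retract X (((externalTensor k A B).obj M).obj N)) := by
  have : IsNoetherianRing (A ⊗[k] B) := isNoetherianRing_of_finite k _
  have : IsSimpleModule (A ⊗[k] B) X := isSimpleModule_of_simple X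
  have : Module.Finite k X := .trans (A ⊗[k] B) X
  obtain ⟨M, N, _, kM, _, _, _, kN, _, _, _, _, i, r, h⟩ :=
    exists_retract_external (k := k) (A := A) (B := B) X
  -- the `k`-module structures are determined by those over `A` and `B`
  obtain rfl : kM = ModuleCat.moduleOfAlgebraModule (k := k) (A := A) (ModuleCat.of A M) :=
    Module.ext' _ _ fun c x => (algebraMap_smul A c x).symm
  obtain rfl : kN = ModuleCat.moduleOfAlgebraModule (k := k) (A := B) (ModuleCat.of B N) :=
    Module.ext' _ _ fun c x => (algebraMap_smul B c x).symm
  exact ⟨FGModuleCat.of A M, FGModuleCat.of B N, ⟨{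
    i := FGModuleCat.ofHom i
    r := FGModuleCat.ofHom r
    retract := by ext x; exact h x }⟩⟩

lemma simple_obj_of_isEquivalence {T K : Type*} [Category* T] [Preadditive T] [Category* K]
    [Preadditive K] (F : T ⥤ K) [F.Additive] [F.IsEquivalence] (t : T) [Simple t] :
    Simple (F.obj t) where
  mono_isIso_iff_nonzero {Y} f _ := by
    let e := F.objObjPreimageIso Y
    let g := F.preimage (e.hom ≫ f)
    have hg : F.map g = e.hom ≫ f := F.map_preimage _
    have : Mono (F.map g) := by rw [hg]; infer_instance
    have : Mono g := F.mono_of_mono_map this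
    rw [← isIso_comp_left_iff e.hom f, ← hg, isIso_iff_of_reflects_iso,
      Simple.mono_isIso_iff_nonzero g, not_iff_not, ← F.map_eq_zero_iff, hg]
    exact ⟨fun h => (cancel_epi e.hom).1 (h.trans comp_zero.symm), fun h => by rw [h, comp_zero]⟩

variable {C : Type u₁} [Category.{v} C] [Abelian C] [Linear k C]
  {D : Type u₂} [Category.{v} D] [Abelian D] [Linear k D]
  {T : Type (v + 1)} [Category.{v} T] [Abelian T] [Linear k T]
  {box : C ⥤ D ⥤ T} {p : C} {q : D} [Projective p] [Projective q]
  [∀ c : C, Module.Finite k (p ⟶ c)] [∀ d : D, Module.Finite k (q ⟶ d)]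

/-- Over a perfect field, every simple object of a Deligne product is a retract of an object
`c ⊠ d`. -/
lemma IsDeligneProduct.exists_retract_box [PerfectField k] (hbox : IsDeligneProduct k box)
    (hp : Generates p) (hq : Generates q) (t : T) [Simple t] :
    ∃ (c : C) (d : D), Nonempty (Retract t ((box.obj c).obj d)) := by
  obtain ⟨F, _, hF, ⟨ψ⟩⟩ := hbox.exists_equivalence hp hq
  have := hF.additive
  have : Simple (F.obj t) := simple_obj_of_isEquivalence F t
  obtain ⟨M, N, ⟨ρ⟩⟩ := exists_retract_externalTensor (F.obj t)
  have : IsNoetherianRing (End p)ᵐᵒᵖ := isNoetherianRing_of_finite k _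
  have : IsNoetherianRing (End q)ᵐᵒᵖ := isNoetherianRing_of_finite k _
  obtain ⟨c, ⟨e⟩⟩ := exists_homFG_iso (AlgHom.id k (End p)ᵐᵒᵖ) Function.bijective_id M
  obtain ⟨d, ⟨f⟩⟩ := exists_homFG_iso (AlgHom.id k (End q)ᵐᵒᵖ) Function.bijective_id N
  refine ⟨c, d, ⟨?_⟩⟩
  let ε : ((externalTensor k _ _).obj M).obj N ≅ F.obj ((box.obj c).obj d) :=
    ((externalTensor k _ _).mapIso e.symm).app N ≪≫
      ((externalTensor k _ _).obj _).mapIso f.symm ≪≫ (ψ.symm.app c).app d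
  let ρ' := ρ.trans (Retract.ofIso ε)
  exact ⟨F.preimage ρ'.i, F.preimage ρ'.r, F.map_injective (by simp)⟩

end SimpleModules

/-! ### Flatness and bilinear functors -/

section Flatness

variable {k : Type*} [Field k] {A T L : Type*} [Category* A] [Abelian A] [Linear k A] [Category* T]
  [Abelian T] [Linear k T] [Category* L] [Abelian L] [Linear k L]

lemma IsLinearFunctor.exact_map {F : A ⥤ L} (hF : IsLinearFunctor k F) {S : ShortComplex A}
    (hS : S.ShortExact) :
    have := hF.additive
    (S.map F).Exact ∧ Epi (F.map S.g) :=
  have := hF.additive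
  (F.preservesFiniteColimits_tfae.out 3 0 :).1 hF.rightExact S hS

/-- If `F(V, -)` preserves monomorphisms, then a monomorphism `U ⟶ V` induces monomorphisms
`F(U, Y) ⟶ F(V, Y)`, provided that every simple object is a retract of an object `Z` for which
`F(-, Z)` preserves monomorphisms. -/
lemma IsBilinearFunctor.mono_map_app {F : A ⥤ T ⥤ L} (hF : IsBilinearFunctor k F)
    (hart : ∀ X : T, IsArtinianObject X)
    (hsimple : ∀ X : T, Simple X → ∃ Z, Nonempty (Retract X Z) ∧
      (F.flip.obj Z).PreservesMonomorphisms)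
    {U V : A} (f : U ⟶ V) [Mono f] [(F.obj V).PreservesMonomorphisms] (Y : T)
    [IsNoetherianObject Y] : Mono ((F.map f).app Y) := by
  have hU := hF.right U
  have hV := hF.right V
  have := hU.additive
  have := hV.additive
  refine finiteLength_induction (Q := fun Y => Mono ((F.map f).app Y)) hart (fun X hX => ?_)
    (fun X hX => ?_) (fun S hS h₁ h₃ => ?_) Y
  · exact ((F.obj U).map_isZero hX).mono _
  · obtain ⟨Z, ⟨r⟩, _⟩ := hsimple X hX
    have : Mono ((F.map f).app Z) := inferInstanceAs (Mono ((F.flip.obj Z).map f))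
    have : Mono ((F.map f).app X ≫ (F.obj V).map r.i) := by
      rw [← (F.map f).naturality]
      have : Mono ((F.obj U).map r.i) := inferInstanceAs (Mono (r.map (F.obj U)).i)
      infer_instance
    exact mono_of_mono _ ((F.obj V).map r.i)
  · have := hS.mono_f
    let φ := S.mapNatTrans (F.map f)
    have : Mono φ.τ₁ := h₁
    have : Mono φ.τ₃ := h₃
    have hVf : Mono (S.map (F.obj V)).f := inferInstanceAs (Mono ((F.obj V).map S.f))
    have : Mono (S.map (F.obj U)).f := by
      have : Mono ((S.map (F.obj U)).f ≫ φ.τ₂) := by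
        rw [← φ.comm₁₂]; infer_instance
      exact mono_of_mono _ φ.τ₂
    exact ShortComplex.mono_τ₂_of_exact_of_mono φ (hU.exact_map hS).1

/-- A right exact functor sends `kernel h ⟶ A ⟶ B` to an exact sequence if it preserves the
monomorphism `image h ⟶ B`. -/
lemma IsLinearFunctor.exact_map_kernel {G : A ⥤ L} (hG : IsLinearFunctor k G) {X Y : A} (h : X ⟶ Y)
    [Mono (G.map (image.ι h))] :
    (ShortComplex.mk (G.map (kernel.ι h)) (G.map h)
      (by have := hG.additive; rw [← G.map_comp, kernel.condition, G.map_zero])).Exact := by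
  have := hG.additive
  let S : ShortComplex A := ShortComplex.mk (kernel.ι h) (factorThruImage h)
    (by rw [← cancel_mono (image.ι h), Category.assoc, image.fac, kernel.condition, zero_comp])
  have hS : S.ShortExact :=
    { exact := by
        let φ : S ⟶ ShortComplex.mk (kernel.ι h) h (kernel.condition h) :=
          { τ₁ := 𝟙 _, τ₂ := 𝟙 _, τ₃ := image.ι h }
        exact (ShortComplex.exact_iff_of_epi_of_isIso_of_mono φ).2 (ShortComplex.exact_kernel h)
      mono_f := inferInstanceAs (Mono (kernel.ι h))
      epi_g := inferInstanceAs (Epi (factorThruImage h)) }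
  let φ : S.map G ⟶ ShortComplex.mk (G.map (kernel.ι h)) (G.map h)
      (by rw [← G.map_comp, kernel.condition, G.map_zero]) :=
    { τ₁ := 𝟙 _
      τ₂ := 𝟙 _
      τ₃ := G.map (image.ι h)
      comm₁₂ := (Category.id_comp _).trans (Category.comp_id _).symm
      comm₂₃ := by
        change 𝟙 _ ≫ G.map h = G.map (factorThruImage h) ≫ _
        rw [← G.map_comp, image.fac, Category.id_comp] }
  have : Epi φ.τ₁ := inferInstanceAs (Epi (𝟙 _))
  have : IsIso φ.τ₂ := inferInstanceAs (IsIso (𝟙 _))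
  have : Mono φ.τ₃ := ‹Mono (G.map (image.ι h))›
  exact (ShortComplex.exact_iff_of_epi_of_isIso_of_mono φ).1 (hG.exact_map hS).1

end Flatness

/-! ### Exact pairings -/

section ExactPairing

variable {T : Type*} [Category* T] [MonoidalCategory T]

open Functor.LaxMonoidal Functor.OplaxMonoidal in
/-- Monoidal functors preserve exact pairings. -/
@[reducible]
def mapExactPairing {S : Type*} [Category* S] [MonoidalCategory S] (F : S ⥤ T) [F.Monoidal]
    (X Y : S) [ExactPairing X Y] : ExactPairing (F.obj X) (F.obj Y) where
  coevaluation' := ε F ≫ F.map (η_ X Y) ≫ δ F X Y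
  evaluation' := μ F Y X ≫ F.map (ε_ X Y) ≫ η F
  coevaluation_evaluation' := by
    calc _ = F.obj Y ◁ ε F ≫ μ F Y (𝟙_ S) ≫
          F.map (Y ◁ η_ X Y ≫ (α_ Y X Y).inv ≫ ε_ X Y ▷ Y) ≫ δ F (𝟙_ S) Y ≫ η F ▷ F.obj Y := by
            simp only [F.map_comp, Functor.Monoidal.map_whiskerLeft,
              Functor.Monoidal.map_whiskerRight, Functor.Monoidal.map_associator_inv,
              MonoidalCategory.whiskerLeft_comp, comp_whiskerRight, Category.assoc,
              Functor.Monoidal.μ_δ_assoc]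
      _ = _ := by
            rw [ExactPairing.coevaluation_evaluation, F.map_comp,
              Functor.LaxMonoidal.right_unitality F Y, Functor.OplaxMonoidal.left_unitality F Y]
            simp only [Category.assoc]
  evaluation_coevaluation' := by
    calc _ = ε F ▷ F.obj X ≫ μ F (𝟙_ S) X ≫
          F.map (η_ X Y ▷ X ≫ (α_ X Y X).hom ≫ X ◁ ε_ X Y) ≫ δ F X (𝟙_ S) ≫ F.obj X ◁ η F := by
            simp only [F.map_comp, Functor.Monoidal.map_whiskerLeft,
              Functor.Monoidal.map_whiskerRight, Functor.Monoidal.map_associator,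
              MonoidalCategory.whiskerLeft_comp, comp_whiskerRight, Category.assoc,
              Functor.Monoidal.μ_δ_assoc]
      _ = _ := by
            rw [ExactPairing.evaluation_coevaluation, F.map_comp,
              Functor.LaxMonoidal.left_unitality F X, Functor.OplaxMonoidal.right_unitality F X]
            simp only [Category.assoc]

/-- Exact pairings are formed componentwise in a product. -/
@[reducible]
def prodExactPairing {C D : Type*} [Category* C] [MonoidalCategory C] [Category* D]
    [MonoidalCategory D] (X Y : C) (X' Y' : D) [ExactPairing X Y] [ExactPairing X' Y'] :
    ExactPairing (X, X') (Y, Y') where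
  coevaluation' := (η_ X Y, η_ X' Y')
  evaluation' := (ε_ X Y, ε_ X' Y')
  coevaluation_evaluation' := by
    ext
    · simp
    · simp
  evaluation_coevaluation' := by
    ext
    · simp
    · simp

/-- An exact pairing of `P` and `Q` descends along an epimorphism `π : P ⟶ X` and a monomorphism
`ι : Y ⟶ Q` if its coevaluation and evaluation do. -/
lemma nonempty_exactPairing_of_epi_mono {P Q X Y : T} [ExactPairing P Q] (π : P ⟶ X) (ι : Y ⟶ Q)
    [Epi π] [Mono ι] (c : 𝟙_ T ⟶ X ⊗ Y) (e : Y ⊗ X ⟶ 𝟙_ T)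
    (hc : c ≫ X ◁ ι = η_ P Q ≫ π ▷ Q) (he : Y ◁ π ≫ e = ι ▷ P ≫ ε_ P Q) :
    Nonempty (ExactPairing X Y) := by
  have : Mono (𝟙_ T ◁ ι) := by rw [id_whiskerLeft]; infer_instance
  have : Epi (𝟙_ T ◁ π) := by rw [id_whiskerLeft]; infer_instance
  refine ⟨⟨c, e, ?_, ?_⟩⟩
  · rw [← cancel_mono (𝟙_ T ◁ ι)]
    calc _ = Y ◁ (c ≫ X ◁ ι) ≫ (α_ Y X Q).inv ≫ e ▷ Q := by
            rw [Category.assoc, Category.assoc, ← whisker_exchange]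
            simp
      _ = Y ◁ η_ P Q ≫ (α_ Y P Q).inv ≫ (Y ◁ π ≫ e) ▷ Q := by
            rw [hc]; simp
      _ = ι ▷ _ ≫ Q ◁ η_ P Q ≫ (α_ Q P Q).inv ≫ ε_ P Q ▷ Q := by
            rw [he, comp_whiskerRight, ← associator_inv_naturality_left_assoc,
              whisker_exchange_assoc]
      _ = _ := by simp
  · rw [← cancel_epi (𝟙_ T ◁ π)]
    calc _ = c ▷ P ≫ (α_ X Y P).hom ≫ X ◁ (Y ◁ π ≫ e) := by
            rw [whisker_exchange_assoc]
            simp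
      _ = (c ≫ X ◁ ι) ▷ P ≫ (α_ X Q P).hom ≫ X ◁ ε_ P Q := by
            rw [he]; simp
      _ = η_ P Q ▷ P ≫ (α_ P Q P).hom ≫ P ◁ ε_ P Q ≫ π ▷ _ := by
            rw [hc, whisker_exchange, comp_whiskerRight, Category.assoc,
              associator_naturality_left_assoc]
      _ = _ := by simp

/-- The mirror image of `nonempty_exactPairing_of_epi_mono`. -/
lemma nonempty_exactPairing_of_mono_epi {P Q X Y : T} [ExactPairing Q P] (π : P ⟶ X) (ι : Y ⟶ Q)
    [Epi π] [Mono ι] (c : 𝟙_ T ⟶ Y ⊗ X) (e : X ⊗ Y ⟶ 𝟙_ T)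
    (hc : c ≫ ι ▷ X = η_ Q P ≫ Q ◁ π) (he : π ▷ Y ≫ e = P ◁ ι ≫ ε_ Q P) :
    Nonempty (ExactPairing Y X) := by
  have : Mono (ι ▷ 𝟙_ T) := by rw [whiskerRight_id]; infer_instance
  have : Epi (π ▷ 𝟙_ T) := by rw [whiskerRight_id]; infer_instance
  refine ⟨⟨c, e, ?_, ?_⟩⟩
  · rw [← cancel_epi (π ▷ 𝟙_ T)]
    calc _ = P ◁ c ≫ (α_ P Y X).inv ≫ (π ▷ Y ≫ e) ▷ X := by
            rw [← whisker_exchange_assoc]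
            simp
      _ = P ◁ (c ≫ ι ▷ X) ≫ (α_ P Q X).inv ≫ ε_ Q P ▷ X := by
            rw [he]; simp
      _ = P ◁ η_ Q P ≫ (α_ P Q P).inv ≫ ε_ Q P ▷ P ≫ _ ◁ π := by
            rw [hc, ← whisker_exchange, MonoidalCategory.whiskerLeft_comp, Category.assoc,
              associator_inv_naturality_right_assoc]
      _ = _ := by simp
  · rw [← cancel_mono (ι ▷ 𝟙_ T)]
    calc _ = (c ≫ ι ▷ X) ▷ Y ≫ (α_ Q X Y).hom ≫ Q ◁ e := by
            rw [Category.assoc, Category.assoc, whisker_exchange]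
            simp
      _ = η_ Q P ▷ Y ≫ (α_ Q P Y).hom ≫ Q ◁ (π ▷ Y ≫ e) := by
            rw [hc]; simp
      _ = _ ◁ ι ≫ η_ Q P ▷ Q ≫ (α_ Q P Q).hom ≫ Q ◁ ε_ Q P := by
            rw [he, MonoidalCategory.whiskerLeft_comp, ← associator_naturality_right_assoc,
              ← whisker_exchange_assoc]
      _ = _ := by simp

end ExactPairing

/-! ### Existence of duals -/

section Rigidity

lemma preservesMonomorphisms_tensorLeft {T : Type*} [Category* T] [MonoidalCategory T] (X : T)
    [HasRightDual X] : ((curriedTensor T).obj X).PreservesMonomorphisms :=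
  Functor.preservesMonomorphisms_of_adjunction (tensorLeftAdjunction X Xᘁ)

lemma preservesMonomorphisms_tensorRight {T : Type*} [Category* T] [MonoidalCategory T] (X : T)
    [HasLeftDual X] : ((curriedTensor T).flip.obj X).PreservesMonomorphisms :=
  Functor.preservesMonomorphisms_of_adjunction (tensorRightAdjunction (ᘁX) X)

variable {k : Type*} [Field k] {T : Type*} [Category* T] [Abelian T] [Linear k T]

lemma IsBilinearFunctor.flip {A B L : Type*} [Category* A] [Abelian A] [Linear k A]
    [Category* B] [Abelian B] [Linear k B] [Category* L] [Abelian L] [Linear k L] {F : A ⥤ B ⥤ L}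
    (hF : IsBilinearFunctor k F) : IsBilinearFunctor k F.flip :=
  ⟨hF.left, hF.right⟩

/-- A right exact functor preserving the monomorphisms `kernel h ⟶ X` and `image h ⟶ Y` preserves
the kernel of `h : X ⟶ Y`. -/
lemma IsLinearFunctor.exists_lift_kernel {L : Type*} [Category* L] [Abelian L] [Linear k L]
    {G : T ⥤ L} (hG : IsLinearFunctor k G) {X Y : T} (h : X ⟶ Y) [Mono (G.map (image.ι h))]
    [hm : Mono (G.map (kernel.ι h))] {W : L} (a : W ⟶ G.obj X) (ha : a ≫ G.map h = 0) :
    ∃ c : W ⟶ G.obj (kernel h), c ≫ G.map (kernel.ι h) = a := by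
  have hE := hG.exact_map_kernel h
  have : Mono (ShortComplex.mk (G.map (kernel.ι h)) (G.map h) (by
    have := hG.additive; rw [← G.map_comp, kernel.condition, G.map_zero])).f := hm
  exact ⟨hE.lift a ha, hE.lift_f a ha⟩

/-- A right exact functor preserves cokernels. -/
lemma IsLinearFunctor.exists_desc {L : Type*} [Category* L] [Abelian L] [Linear k L]
    {F : T ⥤ L} (hF : IsLinearFunctor k F) {X Y Z : T} {f : X ⟶ Y} {g : Y ⟶ Z} {w : f ≫ g = 0}
    (hc : IsColimit (CokernelCofork.ofπ g w)) {W : L} (a : F.obj Y ⟶ W) (ha : F.map f ≫ a = 0) :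
    ∃ e : F.obj Z ⟶ W, F.map g ≫ e = a := by
  have := hF.additive
  have := hF.rightExact
  have : Epi g := Cofork.IsColimit.epi hc
  have hE := ((F.preservesFiniteColimits_tfae.out 3 1 :).1 hF.rightExact
    (ShortComplex.mk f g w) ⟨ShortComplex.exact_of_g_is_cokernel _ hc, this⟩).1
  have : Epi ((ShortComplex.mk f g w).map F).g := inferInstanceAs (Epi (F.map g))
  exact ⟨hE.desc a ha, hE.g_desc a ha⟩

variable [MonoidalCategory T]

lemma IsLinearMonoidal.monoidalPreadditive (hT : IsLinearMonoidal k T) : MonoidalPreadditive T where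
  whiskerLeft_zero {X} _ _ := have := (hT.right X).additive; ((curriedTensor T).obj X).map_zero _ _
  zero_whiskerRight {X} _ _ :=
    have := (hT.left X).additive; ((curriedTensor T).flip.obj X).map_zero _ _
  whiskerLeft_add {X} _ _ _ _ := have := (hT.right X).additive; ((curriedTensor T).obj X).map_add
  add_whiskerRight {X} _ _ _ _ :=
    have := (hT.left X).additive; ((curriedTensor T).flip.obj X).map_add

variable (hT : IsLinearMonoidal k T) (hart : ∀ X : T, IsArtinianObject X)
  (hnoeth : ∀ X : T, IsNoetherianObject X)

include hT hart hnoeth in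
/-- The cokernel of `f : P₁ ⟶ P₀` has the kernel of `P₀ᘁ ⟶ P₁ᘁ` as right dual. -/
lemma exists_rightDual_of_isColimit
    (hsimple : ∀ X : T, Simple X → ∃ Z, Nonempty (Retract X Z) ∧ Nonempty (HasRightDual Z))
    {P₀ P₁ X : T} [HasRightDual P₀] [HasRightDual P₁] {f : P₁ ⟶ P₀} {g : P₀ ⟶ X} {w : f ≫ g = 0}
    (hc : IsColimit (CokernelCofork.ofπ g w)) : Nonempty (HasRightDual X) := by
  have := hT.monoidalPreadditive
  have : Epi g := Cofork.IsColimit.epi hc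
  have hmono {U V : T} (i : U ⟶ V) [Mono i] [HasLeftDual V] : Mono (X ◁ i) := by
    have := preservesMonomorphisms_tensorRight V
    have := hnoeth X
    refine hT.flip.mono_map_app hart (fun S hS => ?_) i X
    obtain ⟨Z, hZ, ⟨_⟩⟩ := hsimple S hS
    exact ⟨Z, hZ, preservesMonomorphisms_tensorLeft Z⟩
  have : HasLeftDual P₀ᘁ := ⟨P₀⟩
  have : HasLeftDual P₁ᘁ := ⟨P₁⟩
  have : Mono (((curriedTensor T).obj X).map (image.ι (rightAdjointMate f))) :=
    hmono (image.ι (rightAdjointMate f))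
  have : Mono (((curriedTensor T).obj X).map (kernel.ι (rightAdjointMate f))) :=
    hmono (kernel.ι (rightAdjointMate f))
  have hcoev : (η_ P₀ P₀ᘁ ≫ g ▷ P₀ᘁ) ≫ X ◁ (rightAdjointMate f) = 0 := by
    rw [Category.assoc, ← whisker_exchange, ← Category.assoc, coevaluation_comp_rightAdjointMate,
      Category.assoc, ← comp_whiskerRight, w, MonoidalPreadditive.zero_whiskerRight, comp_zero]
  have hev :
      kernel (rightAdjointMate f) ◁ f ≫ kernel.ι (rightAdjointMate f) ▷ P₀ ≫ ε_ P₀ P₀ᘁ = 0 := by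
    rw [whisker_exchange_assoc, ← rightAdjointMate_comp_evaluation, ← comp_whiskerRight_assoc,
      kernel.condition, MonoidalPreadditive.zero_whiskerRight, zero_comp]
  obtain ⟨c, hc'⟩ := (hT.right X).exists_lift_kernel (rightAdjointMate f) _ hcoev
  obtain ⟨e, he⟩ := (hT.right (kernel (rightAdjointMate f))).exists_desc hc _ hev
  obtain ⟨h⟩ := nonempty_exactPairing_of_epi_mono g (kernel.ι (rightAdjointMate f)) c e hc' he
  exact ⟨⟨kernel (rightAdjointMate f)⟩⟩

include hT hart hnoeth in
/-- The cokernel of `f : P₁ ⟶ P₀` has the kernel of `ᘁP₀ ⟶ ᘁP₁` as left dual. -/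
lemma exists_leftDual_of_isColimit
    (hsimple : ∀ X : T, Simple X → ∃ Z, Nonempty (Retract X Z) ∧ Nonempty (HasLeftDual Z))
    {P₀ P₁ X : T} [HasLeftDual P₀] [HasLeftDual P₁] {f : P₁ ⟶ P₀} {g : P₀ ⟶ X} {w : f ≫ g = 0}
    (hc : IsColimit (CokernelCofork.ofπ g w)) : Nonempty (HasLeftDual X) := by
  have := hT.monoidalPreadditive
  have : Epi g := Cofork.IsColimit.epi hc
  have hmono {U V : T} (i : U ⟶ V) [Mono i] [HasRightDual V] : Mono (i ▷ X) := by
    have := preservesMonomorphisms_tensorLeft V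
    have := hnoeth X
    refine IsBilinearFunctor.mono_map_app hT hart (fun S hS => ?_) i X
    obtain ⟨Z, hZ, ⟨_⟩⟩ := hsimple S hS
    exact ⟨Z, hZ, preservesMonomorphisms_tensorRight Z⟩
  have : HasRightDual (ᘁP₀) := ⟨P₀⟩
  have : HasRightDual (ᘁP₁) := ⟨P₁⟩
  have : Mono (((curriedTensor T).flip.obj X).map (image.ι (leftAdjointMate f))) :=
    hmono (image.ι (leftAdjointMate f))
  have : Mono (((curriedTensor T).flip.obj X).map (kernel.ι (leftAdjointMate f))) :=
    hmono (kernel.ι (leftAdjointMate f))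
  have hcoev : (η_ (ᘁP₀) P₀ ≫ (ᘁP₀) ◁ g) ≫ (leftAdjointMate f) ▷ X = 0 := by
    rw [Category.assoc, whisker_exchange, ← Category.assoc, coevaluation_comp_leftAdjointMate,
      Category.assoc, ← MonoidalCategory.whiskerLeft_comp, w,
      MonoidalPreadditive.whiskerLeft_zero, comp_zero]
  have hev :
      f ▷ kernel (leftAdjointMate f) ≫ P₀ ◁ kernel.ι (leftAdjointMate f) ≫ ε_ (ᘁP₀) P₀ = 0 := by
    rw [← whisker_exchange_assoc, ← leftAdjointMate_comp_evaluation,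
      ← whiskerLeft_comp_assoc, kernel.condition, MonoidalPreadditive.whiskerLeft_zero, zero_comp]
  obtain ⟨c, hc'⟩ := (hT.left X).exists_lift_kernel (leftAdjointMate f) _ hcoev
  obtain ⟨e, he⟩ := (hT.left (kernel (leftAdjointMate f))).exists_desc hc _ hev
  obtain ⟨h⟩ := nonempty_exactPairing_of_mono_epi g (kernel.ι (leftAdjointMate f)) c e hc' he
  exact ⟨⟨kernel (leftAdjointMate f)⟩⟩

end Rigidity

section BoxDuals

/-- A finite direct sum of copies of `p ⊠ q` is of the form `c ⊠ q`. -/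
lemma IsBilinearFunctor.exists_biproduct_iso {k A B T : Type*} [Field k] [Category* A] [Abelian A]
    [Linear k A] [Category* B] [Abelian B] [Linear k B] [Category* T] [Abelian T] [Linear k T]
    {box : A ⥤ B ⥤ T} (hbox : IsBilinearFunctor k box) (p : A) (q : B)
    (n : ℕ) : ∃ c, Nonempty ((⨁ fun _ : Fin n => (box.obj p).obj q) ≅ (box.obj c).obj q) := by
  have := (hbox.left q).additive
  have : PreservesFiniteBiproducts (box.flip.obj q) :=
    Functor.preservesFiniteBiproductsOfAdditive _
  exact ⟨⨁ fun _ : Fin n => p, ⟨((box.flip.obj q).mapBiproduct fun _ : Fin n => p).symm⟩⟩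

/-- Right duals are invariant under isomorphism. -/
@[reducible]
def hasRightDualOfIso {T : Type*} [Category* T] [MonoidalCategory T] {X Y : T} (e : X ≅ Y)
    [HasRightDual Y] : HasRightDual X :=
  have := exactPairingCongrLeft (Y := Yᘁ) e
  ⟨Yᘁ⟩

/-- Left duals are invariant under isomorphism. -/
@[reducible]
def hasLeftDualOfIso {T : Type*} [Category* T] [MonoidalCategory T] {X Y : T} (e : X ≅ Y)
    [HasLeftDual Y] : HasLeftDual X :=
  have := exactPairingCongrRight (X := ᘁY) e
  ⟨ᘁY⟩

lemma nonempty_rightDual_box {C D T : Type*} [Category* C] [MonoidalCategory C]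
    [Category* D] [MonoidalCategory D] [Category* T] [MonoidalCategory T] (box : C ⥤ D ⥤ T)
    [(Functor.uncurry.obj box).Monoidal] (c : C) (d : D) [HasRightDual c] [HasRightDual d] :
    Nonempty (HasRightDual ((box.obj c).obj d)) :=
  have := prodExactPairing c cᘁ d dᘁ
  ⟨{ rightDual := _, exact := mapExactPairing (Functor.uncurry.obj box) (c, d) (cᘁ, dᘁ) }⟩

lemma nonempty_leftDual_box {C D T : Type*} [Category* C] [MonoidalCategory C]
    [Category* D] [MonoidalCategory D] [Category* T] [MonoidalCategory T] (box : C ⥤ D ⥤ T)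
    [(Functor.uncurry.obj box).Monoidal] (c : C) (d : D) [HasLeftDual c] [HasLeftDual d] :
    Nonempty (HasLeftDual ((box.obj c).obj d)) :=
  have := prodExactPairing (ᘁc) c (ᘁd) d
  ⟨{ leftDual := _, exact := mapExactPairing (Functor.uncurry.obj box) (ᘁc, ᘁd) (c, d) }⟩

variable {k : Type v} [Field k] {C : Type u₁} [Category.{v} C] [Abelian C] [Linear k C]
  [MonoidalCategory C] {D : Type u₂} [Category.{v} D] [Abelian D] [Linear k D] [MonoidalCategory D]
  {T : Type (v + 1)} [Category.{v} T] [Abelian T] [Linear k T] [MonoidalCategory T]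
  {box : C ⥤ D ⥤ T} [(Functor.uncurry.obj box).Monoidal]

/-- The Deligne product of finite tensor categories over a perfect field is a finite tensor
category. -/
theorem IsDeligneProduct.isFiniteTensorCategory [PerfectField k] (hbox : IsDeligneProduct k box)
    (hT : IsLinearMonoidal k T) (hC : IsFiniteTensorCategory k C)
    (hD : IsFiniteTensorCategory k D) : IsFiniteTensorCategory k T := by
  obtain ⟨p, _, hp⟩ := hC.finite.exists_projective_generates
  obtain ⟨q, _, hq⟩ := hD.finite.exists_projective_generates
  have := hC.finite.finiteDimensional_hom p
  have := hD.finite.finiteDimensional_hom q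
  have hfin := hbox.isFiniteLinearCategory hp hq
  have hr (c : C) (d : D) : Nonempty (HasRightDual ((box.obj c).obj d)) := by
    obtain ⟨_⟩ := hC.exists_rightDual c
    obtain ⟨_⟩ := hD.exists_rightDual d
    exact nonempty_rightDual_box box c d
  have hl (c : C) (d : D) : Nonempty (HasLeftDual ((box.obj c).obj d)) := by
    obtain ⟨_⟩ := hC.exists_leftDual c
    obtain ⟨_⟩ := hD.exists_leftDual d
    exact nonempty_leftDual_box box c d
  refine ⟨hfin, hT, fun X => ?_, fun X => ?_⟩
  all_goals
    obtain ⟨m, n, f, g, w, ⟨hc⟩⟩ := (hbox.generates_box hp hq).exists_presentation X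
    obtain ⟨c₁, ⟨e₁⟩⟩ := hbox.bilinear.exists_biproduct_iso p q m
    obtain ⟨c₀, ⟨e₀⟩⟩ := hbox.bilinear.exists_biproduct_iso p q n
  · obtain ⟨_⟩ := hl c₁ q
    obtain ⟨_⟩ := hl c₀ q
    have : HasLeftDual (⨁ fun _ : Fin m => (box.obj p).obj q) := hasLeftDualOfIso e₁
    have : HasLeftDual (⨁ fun _ : Fin n => (box.obj p).obj q) := hasLeftDualOfIso e₀
    refine exists_leftDual_of_isColimit hT hfin.artinian hfin.noetherian (fun S _ => ?_) hc
    obtain ⟨c, d, h⟩ := hbox.exists_retract_box hp hq S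
    exact ⟨_, h, hl c d⟩
  · obtain ⟨_⟩ := hr c₁ q
    obtain ⟨_⟩ := hr c₀ q
    have : HasRightDual (⨁ fun _ : Fin m => (box.obj p).obj q) := hasRightDualOfIso e₁
    have : HasRightDual (⨁ fun _ : Fin n => (box.obj p).obj q) := hasRightDualOfIso e₀
    refine exists_rightDual_of_isColimit hT hfin.artinian hfin.noetherian (fun S _ => ?_) hc
    obtain ⟨c, d, h⟩ := hbox.exists_retract_box hp hq S
    exact ⟨_, h, hr c d⟩

end BoxDuals

/-! ### Exactness of module categories -/

section Exactness

open scoped MonoidalLeftAction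

section Action

variable {T P : Type*} [Category* T] [MonoidalCategory T] [Category* P] [MonoidalLeftAction T P]

/-- The triangle identity for the adjunction between the actions of `Xᘁ` and `X`. -/
lemma action_triangle (X : T) [HasRightDual X] (A : P) :
    (λₗ[T] (X ⊙ₗ A)).inv ≫ η_ X Xᘁ ⊵ₗ (X ⊙ₗ A) ≫ (αₗ X Xᘁ (X ⊙ₗ A)).hom ≫
      X ⊴ₗ ((αₗ Xᘁ X A).inv ≫ ε_ X Xᘁ ⊵ₗ A ≫ (λₗ[T] A).hom) = 𝟙 (X ⊙ₗ A) := by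
  have h : ((λ_ X).inv ≫ (η_ X Xᘁ ▷ X ≫ (α_ X Xᘁ X).hom ≫ X ◁ ε_ X Xᘁ) ≫
      (ρ_ X).hom) ⊵ₗ A = 𝟙 _ := by
    rw [ExactPairing.evaluation_coevaluation]
    simp
  have hα : (α_ X Xᘁ X).hom ⊵ₗ A = (αₗ (X ⊗ Xᘁ) X A).hom ≫ (αₗ X Xᘁ (X ⊙ₗ A)).hom ≫
      X ⊴ₗ (αₗ Xᘁ X A).inv ≫ (αₗ X (Xᘁ ⊗ X) A).inv := by
    rw [← MonoidalLeftAction.associator_actionHom_assoc]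
    simp
  have hl : (λ_ X).inv ⊵ₗ A = (λₗ[T] (X ⊙ₗ A)).inv ≫ (αₗ (𝟙_ T) X A).inv := by
    rw [← cancel_epi ((λ_ X).hom ⊵ₗ A), MonoidalLeftAction.hom_inv_actionHomLeft]
    simp
  refine Eq.trans ?_ h
  simp [hα, hl, -ExactPairing.evaluation_coevaluation, -ExactPairing.evaluation_coevaluation_assoc]

/-- The action of an object with a right dual preserves monomorphisms. -/
lemma mono_actionHomRight (X : T) [HasRightDual X] {A B : P} (f : A ⟶ B) [Mono f] :
    Mono (X ⊴ₗ f) where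
  right_cancellation {W} g h hgh := by
    -- a morphism to `X ⊙ₗ A` is determined by its transpose `Xᘁ ⊙ₗ W ⟶ A`
    have key (g : W ⟶ X ⊙ₗ A) : g = (λₗ[T] W).inv ≫ η_ X Xᘁ ⊵ₗ W ≫ (αₗ X Xᘁ W).hom ≫
        X ⊴ₗ (Xᘁ ⊴ₗ g ≫ (αₗ Xᘁ X A).inv ≫ ε_ X Xᘁ ⊵ₗ A ≫ (λₗ[T] A).hom) := by
      conv_lhs => rw [← Category.comp_id g, ← action_triangle X A,
        ← MonoidalLeftAction.actionUnitIso_inv_naturality_assoc,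
        MonoidalLeftAction.action_exchange_assoc, MonoidalLeftAction.tensor_actionHomRight_assoc,
        Iso.inv_hom_id_assoc]
      rw [MonoidalLeftAction.actionHomRight_comp X (Xᘁ ⊴ₗ g)]
    have hv : ((αₗ Xᘁ X A).inv ≫ ε_ X Xᘁ ⊵ₗ A ≫ (λₗ[T] A).hom) ≫ f =
        Xᘁ ⊴ₗ X ⊴ₗ f ≫ (αₗ Xᘁ X B).inv ≫ ε_ X Xᘁ ⊵ₗ B ≫ (λₗ[T] B).hom := by
      rw [Category.assoc, Category.assoc, MonoidalLeftAction.actionUnitIso_hom_naturality,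
        ← MonoidalLeftAction.action_exchange_assoc, MonoidalLeftAction.tensor_actionHomRight_assoc,
        Iso.inv_hom_id_assoc]
    rw [key g, key h]
    congr 4
    rw [← cancel_mono f, Category.assoc (Xᘁ ⊴ₗ g), Category.assoc (Xᘁ ⊴ₗ h), hv,
      ← MonoidalLeftAction.actionHomRight_comp_assoc, hgh,
      MonoidalLeftAction.actionHomRight_comp_assoc]

end Action

variable {k : Type v} [Field k]
  {C : Type u₁} [Category.{v} C] [Abelian C] [Linear k C]
  {D : Type u₂} [Category.{v} D] [Abelian D] [Linear k D]
  {T : Type (v + 1)} [Category.{v} T] [Abelian T] [Linear k T] {box : C ⥤ D ⥤ T}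

/-- The external product of projective objects is projective. -/
lemma IsDeligneProduct.projective_box_of_projective (hbox : IsDeligneProduct k box)
    (hC : IsFiniteLinearCategory k C) (hD : IsFiniteLinearCategory k D) (c : C) (d : D)
    [Projective c] [Projective d] : Projective ((box.obj c).obj d) := by
  obtain ⟨p, _, hp⟩ := hC.exists_projective_generates
  obtain ⟨q, _, hq⟩ := hD.exists_projective_generates
  have := hC.finiteDimensional_hom p
  have := hD.finiteDimensional_hom q
  have : Projective ((box.flip.obj q).obj p) := hbox.projective_box hp hq
  have := (hbox.bilinear.left q).additive
  have : Projective ((box.obj c).obj q) := hp.projective_obj (box.flip.obj q) c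
  have := (hbox.bilinear.right c).additive
  exact hq.projective_obj (box.obj c) d

variable [MonoidalCategory C] [MonoidalCategory D] [MonoidalCategory T]
  [(Functor.uncurry.obj box).Monoidal]
  {M : Type u₃} [Category.{v} M] [Abelian M] [Linear k M] [MonoidalLeftAction C M]
  {N : Type u₄} [Category.{v} N] [Abelian N] [Linear k N] [MonoidalLeftAction D N]
  {P : Type (v + 1)} [Category.{v} P] [Abelian P] [Linear k P] [MonoidalLeftAction T P]
  {boxP : M ⥤ N ⥤ P}

/-- The Deligne product of exact module categories over a perfect field is exact. -/
theorem BoxModuleStructure.isExactAction [PerfectField k] (σ : BoxModuleStructure box boxP)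
    (hbox : IsDeligneProduct k box) (hC : IsFiniteLinearCategory k C)
    (hD : IsFiniteLinearCategory k D) (hT : IsFiniteTensorCategory k T)
    (hM : IsFiniteLinearCategory k M) (hN : IsFiniteLinearCategory k N)
    (hMexact : IsExactAction C M) (hNexact : IsExactAction D N)
    (hboxP : IsDeligneProduct k boxP) (hPfin : IsFiniteLinearCategory k P)
    (hP : IsModuleCategory k T P) : IsExactAction T P := by
  intro X _ Y
  obtain ⟨p, _, hp⟩ := hC.exists_projective_generates
  obtain ⟨q, _, hq⟩ := hD.exists_projective_generates
  obtain ⟨p', _, hp'⟩ := hM.exists_projective_generates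
  obtain ⟨q', _, hq'⟩ := hN.exists_projective_generates
  have := hC.finiteDimensional_hom p
  have := hD.finiteDimensional_hom q
  have := hM.finiteDimensional_hom p'
  have := hN.finiteDimensional_hom q'
  have := hPfin.noetherian
  have hXbox (m : M) (n : N) : Projective (X ⊙ₗ (boxP.obj m).obj n) := by
    have := hMexact p inferInstance m
    have := hNexact q inferInstance n
    have : Projective ((box.obj p).obj q ⊙ₗ (boxP.obj m).obj n) :=
      Projective.of_iso (σ.iso p q m n).symm (hboxP.projective_box_of_projective hM hN _ _)
    let F := (MonoidalLeftAction.curriedAction T P).flip.obj ((boxP.obj m).obj n)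
    have : F.Additive := (hP.left _).additive
    exact (hbox.generates_box hp hq).projective_obj F (hFx := ‹_›) X
  obtain ⟨_⟩ := hT.exists_rightDual X
  let F := (MonoidalLeftAction.curriedAction T P).obj X
  have hF : IsLinearFunctor k F := hP.right X
  have := hF.additive
  refine finiteLength_induction (Q := fun Y => Projective (F.obj Y)) hPfin.artinian
    (fun Z hZ => (F.map_isZero hZ).projective) (fun Z _ => ?_) (fun S hS h₁ h₃ => ?_) Y
  · obtain ⟨m, n, ⟨r⟩⟩ := hboxP.exists_retract_box hp' hq' Z
    have : Projective (F.obj ((boxP.obj m).obj n)) := hXbox m n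
    exact (r.map F).projective
  · -- an extension of projective objects is projective, as it splits
    have := hS.mono_f
    have hFS : (S.map F).ShortExact :=
      { exact := (hF.exact_map hS).1
        mono_f := mono_actionHomRight X S.f
        epi_g := (hF.exact_map hS).2 }
    have : Projective (S.map F).X₃ := h₃
    have : Projective (F.obj S.X₁ ⊞ F.obj S.X₃) := inferInstance
    have s := hFS.splittingOfProjective
    exact Projective.of_iso s.isoBinaryBiproduct.symm this

end Exactness

end FinTens

theorem theorem10 (k : Type v) [Field k] [PerfectField k]
    -- finite tensor categories `C` and `D`
    (C : Type u₁) [Category.{v} C] [Abelian C] [Linear k C] [MonoidalCategory C]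
    (hC : FinTens.IsFiniteTensorCategory k C)
    (D : Type u₂) [Category.{v} D] [Abelian D] [Linear k D] [MonoidalCategory D]
    (hD : FinTens.IsFiniteTensorCategory k D)
    -- exact finite left module categories `M` over `C` and `N` over `D`
    (M : Type u₃) [Category.{v} M] [Abelian M] [Linear k M] [MonoidalLeftAction C M]
    (hM : FinTens.IsFiniteModuleCategory k C M) (hMexact : FinTens.IsExactAction C M)
    (N : Type u₄) [Category.{v} N] [Abelian N] [Linear k N] [MonoidalLeftAction D N]
    (hN : FinTens.IsFiniteModuleCategory k D N) (hNexact : FinTens.IsExactAction D N)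
    -- the Deligne product `T` of `C` and `D`, with its induced linear monoidal structure
    (T : Type (v + 1)) [Category.{v} T] [Abelian T] [Linear k T]
    (boxT : C ⥤ D ⥤ T) (hboxT : FinTens.IsDeligneProduct k boxT)
    [MonoidalCategory T] (hT : FinTens.IsLinearMonoidal k T)
    [(Functor.uncurry.obj boxT).Monoidal]
    -- the Deligne product `P` of `M` and `N`, with its induced `T`-module category structure
    (P : Type (v + 1)) [Category.{v} P] [Abelian P] [Linear k P]
    (boxP : M ⥤ N ⥤ P) (hboxP : FinTens.IsDeligneProduct k boxP)
    [MonoidalLeftAction T P] (hP : FinTens.IsModuleCategory k T P)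
    (σ : FinTens.BoxModuleStructure boxT boxP) :
    -- `T` is a finite tensor category and `P` is an exact finite left `T`-module category
    FinTens.IsFiniteTensorCategory k T ∧ FinTens.IsFiniteModuleCategory k T P ∧
      FinTens.IsExactAction T P := by
  have hTfin := hboxT.isFiniteTensorCategory hT hC hD
  obtain ⟨p, _, hp⟩ := hM.finite.exists_projective_generates
  obtain ⟨q, _, hq⟩ := hN.finite.exists_projective_generates
  have := hM.finite.finiteDimensional_hom p
  have := hN.finite.finiteDimensional_hom q
  have hPfin := hboxP.isFiniteLinearCategory hp hq
  exact ⟨hTfin, ⟨hPfin, hP⟩, σ.isExactAction hboxT hC.finite hD.finite hTfin hM.finite hN.finite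
    hMexact hNexact hboxP hPfin hP⟩
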